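/- Let $\mathbb Z$ be a real Hilbert space, let $\mathcal A$ generate a $C_0$-semigroup on $\mathbb Z$, let $\mathcal B:\mathbb R^{n_u}\to\mathbb Z$ and $\mathcal C:\mathbb Z\to\mathbb R^{n_y}$ be bounded linear operators (so that $\mathcal B^*$ is bounded), and let $R$ be a symmetric positive definite $n_u\times n_u$ matrix. Assume that $(\mathcal A,\mathcal B)$ is exponentially stabilizable and $(\mathcal A,\mathcal C)$ is exponentially detectable, and let $\Pi$ be the bounded, self-adjoint, nonnegative solution of the algebraic Riccati equation $$\langle z_2,\Pi\mathcal A z_1\rangle+\langle\mathcal A z_2,\Pi z_1\rangle+\langle\mathcal C z_1,\mathcal C z_2\rangle-\langle\Pi\mathcal B R^{-1}\mathcal B^*\Pi z_1,z_2\rangle=0,\qquad z_1,z_2\in\mathcal D(\mathcal A).$$ Then $\mathcal A_m=\mathcal A-\mathcal B\mathcal K$, where $\mathcal K=R^{-1}\mathcal B^*\Pi$, generates a $C_0$-semigroup $e^{\mathcal A_m t}$, and the observability Gramian $W_o z=\int_0^\infty e^{\mathcal A_m^*\tau}\mathcal C^*\mathcal C e^{\mathcal A_m\tau}z\,d\tau$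 converges for every $z\in\mathbb Z$. Consider, with $f\equiv0$ and $r\equiv0$ and in the sense of mild solutions, the system $$\dot v_p=\mathcal A_m v_p,\qquad \dot v_h=\mathcal A v_h+\mathcal B u,\qquad v=v_p+v_h,$$ with arbitrary initial states in $\mathbb Z$ and the control law $$u_{\rm reg}=-R^{-1}\mathcal B^*\Pi v_h-R^{-1}\mathcal B^* q,\qquad q=W_o v_p,$$ where the static feedforward $W_o v_p(t)$ is the limit, as $T\to\infty$, of $q_T(t)=\int_T^t e^{-\mathcal A_m^*(t-s)}\mathcal C^*\sigma(s)\,ds$ with $\sigma=-\mathcal C v_p$. Let $u_{\rm lqr}(z)=-R^{-1}\mathcal B^*\Pi z$ be the classic LQR law, and let $v^\star$ be a trajectory of $\dot v^\star=\mathcal A v^\star+\mathcal B u_{\rm lqr}(v^\star)$. There are constants $M,\beta>0$, independent of the initial states, such that for all $t\ge0$: (a) as a law for the state $v(t)=z$, that is, with $v_h=z-v_p(t)$, the control law $u_{\rm reg}$ at time $t$ differs from $u_{\rm lqr}(z)$ in norm by at most $Me^{-\beta t}\|v_p(0)\|$, for every $z\in\mathbb Z$; so it converges exponentially fast to the LQR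 law; (b) the error of the control signals is bounded: $\|u_{\rm reg}(t)-u_{\rm lqr}(v^\star(t))\|\le M\big(\|v_p(0)\|+\|v(0)-v^\star(0)\|\big)$. The same bound holds if $v$ is instead the state of the plant $\dot v=\mathcal A v+\mathcal B u_{\rm reg}$ with $v_h=v-v_p$ in the control law. -/

import Mathlib

open Set Filter Topology MeasureTheory

noncomputable section

namespace DyadicControl

variable {Z U Y : Type*} [NormedAddCommGroup Z] [InnerProductSpace ℝ Z] [CompleteSpace Z]
  [NormedAddCommGroup U] [InnerProductSpace ℝ U] [CompleteSpace U]
  [NormedAddCommGroup Y] [InnerProductSpace ℝ Y] [CompleteSpace Y]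

/-- A strongly continuous (`C₀`) semigroup of bounded operators on `Z`; only the values at times
`t ≥ 0` matter. -/
structure IsC0Semigroup (T : ℝ → Z →L[ℝ] Z) : Prop where
  zero : T 0 = ContinuousLinearMap.id ℝ Z
  add : ∀ s t : ℝ, 0 ≤ s → 0 ≤ t → T (s + t) = (T s).comp (T t)
  continuousOn : ∀ z : Z, ContinuousOn (fun t => T t z) (Ici 0)

/-- The (unbounded) operator `A` is the infinitesimal generator of the `C₀` semigroup `T`:
`z` lies in the domain of `A` and `A z = y` if and only if `(T h z - z) / h → y` as `h ↓ 0`. -/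
def Generates (A : Z →ₗ.[ℝ] Z) (T : ℝ → Z →L[ℝ] Z) : Prop :=
  IsC0Semigroup T ∧
    ∀ z y : Z, (z, y) ∈ A.graph ↔
      Tendsto (fun h : ℝ => h⁻¹ • (T h z - z)) (𝓝[>] 0) (𝓝 y)

/-- Exponential stability: `‖T t‖ ≤ M e^{-β t}` for all `t ≥ 0`, with some `M, β > 0`. -/
def IsExpStable (T : ℝ → Z →L[ℝ] Z) : Prop :=
  ∃ M β : ℝ, 0 < M ∧ 0 < β ∧ ∀ t : ℝ, 0 ≤ t → ‖T t‖ ≤ M * Real.exp (-β * t)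

/-- The operator `A + G`, with the domain of `A`, for a bounded operator `G` on `Z`. -/
def boundedPerturbation (A : Z →ₗ.[ℝ] Z) (G : Z →L[ℝ] Z) : Z →ₗ.[ℝ] Z :=
  (G : Z →ₗ[ℝ] Z) +ᵥ A

/-- `(A, B)` is exponentially stabilizable: `A + B F` generates an exponentially stable semigroup
for some bounded feedback `F`. -/
def IsExpStabilizable (A : Z →ₗ.[ℝ] Z) (B : U →L[ℝ] Z) : Prop :=
  ∃ (F : Z →L[ℝ] U) (T : ℝ → Z →L[ℝ] Z),
    Generates (boundedPerturbation A (B.comp F)) T ∧ IsExpStable T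

/-- `(A, C)` is exponentially detectable: `A + L C` generates an exponentially stable semigroup
for some bounded output injection `L`. -/
def IsExpDetectable (A : Z →ₗ.[ℝ] Z) (C : Z →L[ℝ] Y) : Prop :=
  ∃ (L : Y →L[ℝ] Z) (T : ℝ → Z →L[ℝ] Z),
    Generates (boundedPerturbation A (L.comp C)) T ∧ IsExpStable T

/-- Mild solution on `[0, ∞)` of `v' = A v + f (t, v)`, `v 0 = v₀`, where `A` generates `T`. -/
def IsMildSolution (T : ℝ → Z →L[ℝ] Z) (f : ℝ → Z → Z) (v₀ : Z) (v : ℝ → Z) : Prop :=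
  ContinuousOn v (Ici 0) ∧
    ∀ t : ℝ, 0 ≤ t → v t = T t v₀ + ∫ τ in (0 : ℝ)..t, T (t - τ) (f τ (v τ))

/-- The operator `R⁻¹` on `ℝⁿ` with its Euclidean norm (used for positive definite `R`). -/
def weightInv {n : ℕ} (R : Matrix (Fin n) (Fin n) ℝ) :
    EuclideanSpace ℝ (Fin n) →L[ℝ] EuclideanSpace ℝ (Fin n) :=
  Matrix.toEuclideanCLM (𝕜 := ℝ) R⁻¹

/-- The operator `R⁻¹ B*`. -/
def weightedAdjoint {n : ℕ} (B : EuclideanSpace ℝ (Fin n) →L[ℝ] Z)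
    (R : Matrix (Fin n) (Fin n) ℝ) : Z →L[ℝ] EuclideanSpace ℝ (Fin n) :=
  (weightInv R).comp (ContinuousLinearMap.adjoint B)

/-- The gain `K = R⁻¹ B* P` of the linear quadratic regulator. -/
def lqrGain {n : ℕ} (B : EuclideanSpace ℝ (Fin n) →L[ℝ] Z) (R : Matrix (Fin n) (Fin n) ℝ)
    (P : Z →L[ℝ] Z) : Z →L[ℝ] EuclideanSpace ℝ (Fin n) :=
  (weightedAdjoint B R).comp P

/-- `P` is a bounded, self-adjoint, nonnegative solution of the algebraic Riccati equation
`A* P + P A + C* C - P B R⁻¹ B* P = 0`, in its weak form on the domain of `A`. -/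
structure IsRiccatiSolution {n : ℕ} (A : Z →ₗ.[ℝ] Z) (B : EuclideanSpace ℝ (Fin n) →L[ℝ] Z)
    (C : Z →L[ℝ] Y) (R : Matrix (Fin n) (Fin n) ℝ) (P : Z →L[ℝ] Z) : Prop where
  selfAdjoint : IsSelfAdjoint P
  nonneg : ∀ z : Z, 0 ≤ inner ℝ z (P z)
  riccati : ∀ z₁ z₂ : A.domain,
    inner ℝ (z₂ : Z) (P (A z₁)) + inner ℝ (A z₂) (P (z₁ : Z))
      + inner ℝ (C (z₁ : Z)) (C (z₂ : Z))
      - inner ℝ (P (B (lqrGain B R P (z₁ : Z)))) (z₂ : Z) = 0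

/-- The closed-loop operator `A_m = A - B R⁻¹ B* P`, with the domain of `A`. -/
def closedLoop {n : ℕ} (A : Z →ₗ.[ℝ] Z) (B : EuclideanSpace ℝ (Fin n) →L[ℝ] Z)
    (R : Matrix (Fin n) (Fin n) ℝ) (P : Z →L[ℝ] Z) : Z →ₗ.[ℝ] Z :=
  boundedPerturbation A (-(B.comp (lqrGain B R P)))

/-- The integrand `e^{A_m* τ} C* C e^{A_m τ} z` of the observability Gramian. -/
def gramianIntegrand (Tm : ℝ → Z →L[ℝ] Z) (C : Z →L[ℝ] Y) (z : Z) (τ : ℝ) : Z :=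
  ContinuousLinearMap.adjoint (Tm τ) (ContinuousLinearMap.adjoint C (C (Tm τ z)))

/-- The observability Gramian `W_o z = ∫_0^∞ e^{A_m* τ} C* C e^{A_m τ} z dτ`. -/
def obsGramian (Tm : ℝ → Z →L[ℝ] Z) (C : Z →L[ℝ] Y) (z : Z) : Z :=
  ∫ τ in Ioi (0 : ℝ), gramianIntegrand Tm C z τ

/-- The feedforward with horizon `T`: the mild solution
`q(t) = ∫_T^t e^{-A_m* (t - s)} C* σ(s) ds` of `q' = -A_m* q + C* σ`, `q(T) = 0`. -/
def horizonFeedforward (Tm : ℝ → Z →L[ℝ] Z) (C : Z →L[ℝ] Y) (σ : ℝ → Y) (T t : ℝ) : Z :=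
  ∫ s in T..t, ContinuousLinearMap.adjoint (Tm (s - t)) (ContinuousLinearMap.adjoint C (σ s))

/-- The classic linear quadratic regulator `u = -R⁻¹ B* P v`. -/
def lqrLaw {n : ℕ} (B : EuclideanSpace ℝ (Fin n) →L[ℝ] Z) (R : Matrix (Fin n) (Fin n) ℝ)
    (P : Z →L[ℝ] Z) (v : Z) : EuclideanSpace ℝ (Fin n) :=
  -lqrGain B R P v

/-- The dyadic law `u = -R⁻¹ B* P v_h - R⁻¹ B* q` with the static feedforward `q = W_o v_p`. -/
def regLaw {n : ℕ} (Tm : ℝ → Z →L[ℝ] Z) (B : EuclideanSpace ℝ (Fin n) →L[ℝ] Z)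
    (C : Z →L[ℝ] Y) (R : Matrix (Fin n) (Fin n) ℝ) (P : Z →L[ℝ] Z) (vp vh : Z) :
    EuclideanSpace ℝ (Fin n) :=
  -lqrGain B R P vh - weightedAdjoint B R (obsGramian Tm C vp)

end DyadicControl

end

/-! Everything rests on the exponential stability of the closed-loop semigroup `T` of `A_m`, which
is built from that of `A` by inverting the variation-of-constants equation.

Along a closed-loop trajectory `x`, the Riccati equation gives `d/dt ⟨x, P x⟩ = -(‖C x‖² + ⟨K x, B*
P x⟩)` with `K = R⁻¹ B* P`. The last term dominates a multiple of `‖K x‖²`, and `P ≥ 0`, so output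
and control have finite energy, bounded by a multiple of `‖x(0)‖²`
(`IsRiccatiSolution.exists_integral_le`). By detectability `A_m = (A + L C) + (-B K - L C)`: a
stable generator plus a perturbation that sees the state only through `K x` and `C x`. Every
trajectory is then a decaying term plus the convolution of a decaying exponential with a
square-integrable signal. Hence it is bounded and square integrable, and Datko's theorem gives
exponential decay (`IsRiccatiSolution.isExpStable`).

Stability makes the Gramian a bounded operator `W`. With `v_h = z - v_p` the dyadic law is `-K z + E
v_p`, where `E = K - R⁻¹ B* W`; its distance to the LQR law is `‖E v_p‖`, which decays with `v_p = T
v_p(0)`. For the signals, a uniqueness argument rewrites mild solutions over `S` with LQR feedback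
as mild solutions over `T` driven by the feedforward alone (`IsC0Semigroup.eq_of_mild_perturbed`).
The difference of two trajectories is then `T` applied to the initial difference plus a bounded
convolution. -/

namespace DyadicControl

/-! ### Growth bounds, joint continuity and convolutions for `C₀` semigroups. -/

section Semigroup

variable {Z : Type*} [NormedAddCommGroup Z] [InnerProductSpace ℝ Z]
  {T : ℝ → Z →L[ℝ] Z}

theorem IsC0Semigroup.apply_add (hT : IsC0Semigroup T) {s t : ℝ} (hs : 0 ≤ s) (ht : 0 ≤ t)
    (z : Z) : T (s + t) z = T s (T t z) := by
  rw [hT.add s t hs ht]; rfl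

theorem IsC0Semigroup.apply_zero (hT : IsC0Semigroup T) (z : Z) : T 0 z = z := by
  rw [hT.zero]; rfl

/-- Split `t = n t₀ + r` and apply submultiplicativity `n` times. The sign of `c` is free: positive
`c` gives the general growth bound, `c = -1` gives exponential stability. -/
theorem IsC0Semigroup.norm_le_mul_exp_floor (hT : IsC0Semigroup T) {M c t₀ : ℝ} (ht₀ : 0 < t₀)
    (hM : ∀ t ∈ Icc 0 t₀, ‖T t‖ ≤ M) (hc : ‖T t₀‖ ≤ Real.exp c) {t : ℝ} (ht : 0 ≤ t) :
    ‖T t‖ ≤ M * Real.exp (c * ⌊t / t₀⌋₊) := by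
  have hM0 : 0 ≤ M := (norm_nonneg _).trans (hM 0 ⟨le_rfl, ht₀.le⟩)
  have key : ∀ n : ℕ, ∀ r ∈ Icc 0 t₀, ‖T (n * t₀ + r)‖ ≤ M * Real.exp (c * n) := by
    intro n
    induction n with
    | zero => intro r hr; simpa using hM r hr
    | succ n ih =>
      intro r hr
      have h : ((n + 1 : ℕ) : ℝ) * t₀ + r = t₀ + (n * t₀ + r) := by push_cast; ring
      have hnr : 0 ≤ n * t₀ + r := add_nonneg (by positivity) hr.1
      rw [h, hT.add _ _ ht₀.le hnr]
      calc _ ≤ ‖T t₀‖ * ‖T (n * t₀ + r)‖ := ContinuousLinearMap.opNorm_comp_le _ _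
        _ ≤ Real.exp c * (M * Real.exp (c * n)) := by
          gcongr
          exact ih r hr
        _ = _ := by push_cast; rw [mul_add, Real.exp_add, mul_one]; ring
  have h1 := Nat.floor_le (div_nonneg ht ht₀.le)
  have h2 := (Nat.lt_floor_add_one (t / t₀)).le
  rw [le_div_iff₀ ht₀] at h1
  rw [div_le_iff₀ ht₀] at h2
  have := key ⌊t / t₀⌋₊ (t - ⌊t / t₀⌋₊ * t₀) ⟨by linarith, by linarith⟩
  simpa using this

variable [CompleteSpace Z]

theorem IsC0Semigroup.exists_norm_le_Icc (hT : IsC0Semigroup T) (b : ℝ) :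
    ∃ M : ℝ, 0 < M ∧ ∀ t ∈ Icc 0 b, ‖T t‖ ≤ M := by
  obtain ⟨M, hM⟩ := banach_steinhaus (g := fun t : Icc (0 : ℝ) b => T t) (by
    intro z
    have hc : ContinuousOn (fun t => T t z) (Icc 0 b) :=
      (hT.continuousOn z).mono fun t ht => ht.1
    obtain ⟨C, hC⟩ := isCompact_Icc.exists_bound_of_continuousOn hc
    exact ⟨C, fun t => hC t t.2⟩)
  exact ⟨max M 1, by positivity, fun t ht => (hM ⟨t, ht⟩).trans (le_max_left _ _)⟩

theorem IsC0Semigroup.exists_norm_le_exp (hT : IsC0Semigroup T) :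
    ∃ M ω : ℝ, 0 < M ∧ 0 < ω ∧ ∀ t, 0 ≤ t → ‖T t‖ ≤ M * Real.exp (ω * t) := by
  obtain ⟨M, hM, h⟩ := hT.exists_norm_le_Icc 1
  refine ⟨M, ‖T 1‖ + 1, hM, by positivity, fun t ht => ?_⟩
  have hc : ‖T 1‖ ≤ Real.exp (‖T 1‖ + 1) := by
    linarith [Real.add_one_le_exp (‖T 1‖ + 1)]
  refine (hT.norm_le_mul_exp_floor one_pos h hc ht).trans ?_
  gcongr
  rw [div_one]
  exact Nat.floor_le ht

/-- Joint continuity of `(t, z) ↦ T t z` for `t ≥ 0`. -/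
theorem IsC0Semigroup.continuous_max (hT : IsC0Semigroup T) :
    Continuous fun p : ℝ × Z => T (max p.1 0) p.2 := by
  have hc : ∀ z, Continuous fun t : ℝ => T (max t 0) z := fun z =>
    (hT.continuousOn z).comp_continuous (by fun_prop) fun t => le_max_right t 0
  rw [continuous_iff_continuousAt]
  rintro ⟨t₀, z₀⟩
  obtain ⟨M, hM, h⟩ := hT.exists_norm_le_Icc (max t₀ 0 + 1)
  rw [ContinuousAt, tendsto_iff_norm_sub_tendsto_zero]
  have hev : ∀ᶠ p : ℝ × Z in 𝓝 (t₀, z₀), ‖T (max p.1 0) p.2 - T (max t₀ 0) z₀‖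
      ≤ M * ‖p.2 - z₀‖ + ‖T (max p.1 0) z₀ - T (max t₀ 0) z₀‖ := by
    have : ∀ᶠ p : ℝ × Z in 𝓝 (t₀, z₀), p.1 < max t₀ 0 + 1 :=
      continuous_fst.continuousAt.eventually_lt continuousAt_const
        (by simpa using (le_max_left t₀ 0).trans_lt (lt_add_one _))
    filter_upwards [this] with p hp
    have h1 : ‖T (max p.1 0)‖ ≤ M := h _ ⟨le_max_right _ _, max_le hp.le (by positivity)⟩
    calc _ = ‖T (max p.1 0) (p.2 - z₀) + (T (max p.1 0) z₀ - T (max t₀ 0) z₀)‖ := by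
          rw [map_sub]; congr 1; abel
      _ ≤ _ := (norm_add_le _ _).trans (by
          gcongr; exact (ContinuousLinearMap.le_of_opNorm_le _ h1 _))
  refine squeeze_zero' (Eventually.of_forall fun _ => norm_nonneg _) hev ?_
  have : Continuous fun p : ℝ × Z =>
      M * ‖p.2 - z₀‖ + ‖T (max p.1 0) z₀ - T (max t₀ 0) z₀‖ := by
    have h1 : Continuous fun p : ℝ × Z => T (max p.1 0) z₀ := (hc z₀).comp continuous_fst
    exact (continuous_const.mul (continuous_snd.sub continuous_const).norm).add
      (h1.sub continuous_const).norm
  simpa using this.tendsto (t₀, z₀)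

theorem IsC0Semigroup.continuousOn_apply (hT : IsC0Semigroup T) {X : Type*} [TopologicalSpace X]
    {s : Set X} {f : X → ℝ} {g : X → Z} (hf : ContinuousOn f s) (hg : ContinuousOn g s)
    (h0 : ∀ x ∈ s, 0 ≤ f x) : ContinuousOn (fun x => T (f x) (g x)) s := by
  refine (hT.continuous_max.comp_continuousOn (hf.prodMk hg)).congr fun x hx => ?_
  simp [max_eq_left (h0 x hx)]

/-- The convolution `∫ T (t - s) (g s) ds` over `[0, t]`. -/
noncomputable def mildIntegral (T : ℝ → Z →L[ℝ] Z) (g : ℝ → Z) (t : ℝ) : Z :=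
  ∫ s in (0 : ℝ)..t, T (t - s) (g s)

theorem IsC0Semigroup.continuousOn_mildIntegral (hT : IsC0Semigroup T) {g : ℝ → Z}
    (hg : ContinuousOn g (Ici 0)) : ContinuousOn (mildIntegral T g) (Ici 0) := by
  have hg' : Continuous fun s : ℝ => g (max s 0) :=
    hg.comp_continuous (by fun_prop) fun s => le_max_right s 0
  -- The truncations change nothing on the range of integration, but make the integrand jointly
  -- continuous on the whole plane.
  have h : Continuous fun t : ℝ => ∫ s in (0 : ℝ)..t, T (max (t - s) 0) (g (max s 0)) := by
    refine intervalIntegral.continuous_parametric_intervalIntegral_of_continuous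
      (f := fun t s : ℝ => T (max (t - s) 0) (g (max s 0))) ?_ continuous_id
    exact hT.continuous_max.comp
      ((by fun_prop : Continuous fun p : ℝ × ℝ => p.1 - p.2).prodMk (hg'.comp continuous_snd))
  refine h.continuousOn.congr fun t ht => ?_
  refine intervalIntegral.integral_congr fun s hs => ?_
  rw [uIcc_of_le ht] at hs
  simp [max_eq_left hs.1, hs.2]

theorem IsC0Semigroup.intervalIntegrable_conv (hT : IsC0Semigroup T) {g : ℝ → Z}
    (hg : ContinuousOn g (Ici 0)) {a b t : ℝ} (ha : 0 ≤ a) (hab : a ≤ b) (hb : b ≤ t) :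
    IntervalIntegrable (fun s => T (t - s) (g s)) volume a b := by
  refine ContinuousOn.intervalIntegrable ?_
  rw [uIcc_of_le hab]
  exact hT.continuousOn_apply (by fun_prop) (hg.mono fun s hs => ha.trans hs.1)
    fun s hs => by linarith [hs.2]

/-- Restarting a convolution at time `s`. -/
theorem IsC0Semigroup.mildIntegral_add (hT : IsC0Semigroup T) {g : ℝ → Z}
    (hg : ContinuousOn g (Ici 0)) {s h : ℝ} (hs : 0 ≤ s) (hh : 0 ≤ h) :
    mildIntegral T g (s + h) =
      T h (mildIntegral T g s) + mildIntegral T (fun r => g (s + r)) h := by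
  unfold mildIntegral
  rw [← intervalIntegral.integral_add_adjacent_intervals
    (hT.intervalIntegrable_conv hg le_rfl hs (by linarith))
    (hT.intervalIntegrable_conv hg hs (by linarith : s ≤ s + h) le_rfl)]
  congr 1
  · rw [← ContinuousLinearMap.intervalIntegral_comp_comm _
      (hT.intervalIntegrable_conv hg le_rfl hs le_rfl)]
    refine intervalIntegral.integral_congr fun r hr => ?_
    rw [uIcc_of_le hs] at hr
    rw [← hT.apply_add hh (sub_nonneg.2 hr.2)]
    congr 2; ring
  · have := intervalIntegral.integral_comp_add_left (a := 0) (b := h)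
      (fun r => T (s + h - r) (g r)) s
    rw [add_zero] at this
    rw [← this]
    refine intervalIntegral.integral_congr fun r hr => ?_
    simp only
    congr 2; ring

/-- The right derivative at `0` of a convolution. -/
theorem IsC0Semigroup.tendsto_mildIntegral (hT : IsC0Semigroup T) {g : ℝ → Z}
    (hg : ContinuousOn g (Ici 0)) :
    Tendsto (fun h : ℝ => h⁻¹ • mildIntegral T g h) (𝓝[>] 0) (𝓝 (g 0)) := by
  have hg' : Continuous fun s : ℝ => g (max s 0) :=
    hg.comp_continuous (by fun_prop) fun s => le_max_right s 0
  have hF : Continuous fun p : ℝ × ℝ => T (max (p.1 - p.2) 0) (g (max p.2 0)) :=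
    hT.continuous_max.comp
      ((by fun_prop : Continuous fun p : ℝ × ℝ => p.1 - p.2).prodMk (hg'.comp continuous_snd))
  rw [Metric.tendsto_nhdsWithin_nhds]
  intro ε hε
  obtain ⟨δ, hδ, H⟩ := Metric.continuousAt_iff.1 (hF.continuousAt (x := (0, 0))) (ε / 2)
    (by positivity)
  simp only [sub_self, max_self, hT.apply_zero] at H
  refine ⟨δ, hδ, fun {h} hh hd => ?_⟩
  have hh : 0 < h := hh
  rw [Real.dist_eq, sub_zero, abs_of_pos hh] at hd
  have e : mildIntegral T g h - h • g 0 = ∫ s in (0 : ℝ)..h, (T (h - s) (g s) - g 0) := by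
    rw [intervalIntegral.integral_sub (hT.intervalIntegrable_conv hg le_rfl hh.le le_rfl)
      (by simp)]
    simp [mildIntegral]
  have hb : ‖mildIntegral T g h - h • g 0‖ ≤ ε / 2 * |h - 0| := by
    rw [e]
    refine intervalIntegral.norm_integral_le_of_norm_le_const fun s hs => ?_
    rw [uIoc_of_le hh.le] at hs
    have := @H (h, s) (by
      rw [Prod.dist_eq, max_lt_iff]
      simp only [Real.dist_eq, sub_zero, abs_of_pos hh, abs_of_pos hs.1]
      exact ⟨hd, hs.2.trans_lt hd⟩)
    rw [dist_eq_norm, max_eq_left (sub_nonneg.2 hs.2), max_eq_left hs.1.le] at this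
    exact this.le
  rw [sub_zero, abs_of_pos hh] at hb
  have e2 : h⁻¹ • mildIntegral T g h - g 0 = h⁻¹ • (mildIntegral T g h - h • g 0) := by
    rw [smul_sub, smul_smul, inv_mul_cancel₀ hh.ne', one_smul]
  rw [dist_eq_norm, e2, norm_smul, norm_inv, Real.norm_of_nonneg hh.le, inv_mul_lt_iff₀ hh]
  nlinarith

end Semigroup

/-! ### Bounded perturbations of generators. -/

section Perturbation

open scoped BoundedContinuousFunction NNReal

variable {Z : Type*} [NormedAddCommGroup Z] [InnerProductSpace ℝ Z] [CompleteSpace Z]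
  {T : ℝ → Z →L[ℝ] Z}

theorem integral_exp_neg_sub {b : ℝ} (hb : 0 < b) (t : ℝ) :
    ∫ s in (0 : ℝ)..t, Real.exp (-b * (t - s)) = (1 - Real.exp (-b * t)) / b := by
  have h : ∀ s ∈ uIcc 0 t, HasDerivAt (fun s => Real.exp (-b * (t - s)) / b)
      (Real.exp (-b * (t - s))) s := by
    intro s _
    have h1 : HasDerivAt (fun s : ℝ => -b * (t - s)) b s := by
      simpa using ((hasDerivAt_id s).const_sub t).const_mul (-b)
    have := h1.exp.div_const b
    rwa [mul_div_cancel_right₀ _ hb.ne'] at this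
  rw [intervalIntegral.integral_eq_sub_of_hasDerivAt h
    (by apply Continuous.intervalIntegrable; fun_prop)]
  simp [sub_div]

omit [CompleteSpace Z] in
theorem norm_mildIntegral_le {M b : ℝ} (hM : 0 ≤ M) (hb : 0 < b)
    (hT : ∀ t, 0 ≤ t → ‖T t‖ ≤ M * Real.exp (-b * t)) {g : ℝ → Z} {k : ℝ}
    (hg : ∀ s, 0 ≤ s → ‖g s‖ ≤ k) {t : ℝ} (ht : 0 ≤ t) :
    ‖mildIntegral T g t‖ ≤ M / b * k := by
  have hk : 0 ≤ k := (norm_nonneg _).trans (hg 0 le_rfl)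
  have h1 : ‖mildIntegral T g t‖ ≤ ∫ s in (0 : ℝ)..t, M * k * Real.exp (-b * (t - s)) := by
    refine intervalIntegral.norm_integral_le_of_norm_le ht
      (Eventually.of_forall fun s hs => ?_)
      (by apply Continuous.intervalIntegrable; fun_prop)
    calc _ ≤ ‖T (t - s)‖ * ‖g s‖ := ContinuousLinearMap.le_opNorm _ _
      _ ≤ (M * Real.exp (-b * (t - s))) * k := by
        gcongr
        · exact hT _ (sub_nonneg.2 hs.2)
        · exact hg _ hs.1.le
      _ = _ := by ring
  rw [intervalIntegral.integral_const_mul, integral_exp_neg_sub hb] at h1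
  refine h1.trans ?_
  have : (1 - Real.exp (-b * t)) / b ≤ 1 / b := by
    gcongr
    linarith [Real.exp_pos (-b * t)]
  calc _ ≤ M * k * (1 / b) := by gcongr
    _ = _ := by ring

/-- A bounded perturbation of a semigroup whose decay dominates the perturbation, by inverting
`1 - Φ` on the bounded continuous trajectories, `Φ w t = ∫ T (t - s) (G (w s)) ds`. -/
theorem IsC0Semigroup.exists_perturbation_of_decay (hT : IsC0Semigroup T) {M b : ℝ} (hM : 0 ≤ M)
    (hb : 0 < b) (hTb : ∀ t, 0 ≤ t → ‖T t‖ ≤ M * Real.exp (-b * t)) (G : Z →L[ℝ] Z)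
    (hG : M / b * ‖G‖ < 1) :
    ∃ T' : ℝ → Z →L[ℝ] Z, IsC0Semigroup T' ∧
      ∀ z t, 0 ≤ t → T' t z = T t z + mildIntegral T (fun s => G (T' s z)) t := by
  have hcg : ∀ w : ℝ≥0 →ᵇ Z, Continuous fun s : ℝ => G (w s.toNNReal) := fun w =>
    G.continuous.comp (w.continuous.comp continuous_real_toNNReal)
  have hbg : ∀ (w : ℝ≥0 →ᵇ Z) (s : ℝ), 0 ≤ s → ‖G (w s.toNNReal)‖ ≤ ‖G‖ * ‖w‖ := fun w s _ =>
    (G.le_opNorm _).trans (by gcongr; exact w.norm_coe_le_norm _)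
  have hMb : 0 ≤ M / b := by positivity
  have hbd : ∀ (w : ℝ≥0 →ᵇ Z) (t : ℝ≥0),
      ‖mildIntegral T (fun s => G (w s.toNNReal)) t‖ ≤ M / b * ‖G‖ * ‖w‖ := fun w t => by
    rw [mul_assoc]
    exact norm_mildIntegral_le hM hb hTb (hbg w) t.2
  let Φ₀ : (ℝ≥0 →ᵇ Z) →ₗ[ℝ] (ℝ≥0 →ᵇ Z) :=
    { toFun := fun w => BoundedContinuousFunction.ofNormedAddCommGroup
        (fun t : ℝ≥0 => mildIntegral T (fun s => G (w s.toNNReal)) t)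
        ((hT.continuousOn_mildIntegral (hcg w).continuousOn).comp_continuous
          NNReal.continuous_coe fun t => t.2) _ (hbd w)
      map_add' := fun w₁ w₂ => by
        ext t
        simp only [BoundedContinuousFunction.coe_ofNormedAddCommGroup,
          BoundedContinuousFunction.coe_add, Pi.add_apply, mildIntegral, map_add]
        exact intervalIntegral.integral_add
          (hT.intervalIntegrable_conv (hcg w₁).continuousOn le_rfl t.2 le_rfl)
          (hT.intervalIntegrable_conv (hcg w₂).continuousOn le_rfl t.2 le_rfl)
      map_smul' := fun c w => by
        ext t
        simp only [BoundedContinuousFunction.coe_ofNormedAddCommGroup,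
          BoundedContinuousFunction.coe_smul, mildIntegral, map_smul, RingHom.id_apply]
        exact intervalIntegral.integral_smul c _ }
  let Φ : (ℝ≥0 →ᵇ Z) →L[ℝ] (ℝ≥0 →ᵇ Z) := Φ₀.mkContinuous (M / b * ‖G‖) fun w =>
    (BoundedContinuousFunction.norm_le (by positivity)).2 (hbd w)
  have hΦ : ∀ (w : ℝ≥0 →ᵇ Z) (t : ℝ≥0),
      Φ w t = mildIntegral T (fun s => G (w s.toNNReal)) t := fun _ _ => rfl
  have hΦn : ‖Φ‖ < 1 :=
    (LinearMap.mkContinuous_norm_le _ (by positivity) _).trans_lt hG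
  have hJb : ∀ (z : Z) (t : ℝ≥0), ‖T t z‖ ≤ M * ‖z‖ := fun z t => by
    refine ((T t).le_opNorm z).trans ?_
    gcongr
    refine (hTb t t.2).trans ?_
    refine mul_le_of_le_one_right hM (Real.exp_le_one_iff.2 ?_)
    nlinarith [t.2, hb, mul_nonneg hb.le t.2]
  let J₀ : Z →ₗ[ℝ] (ℝ≥0 →ᵇ Z) :=
    { toFun := fun z => BoundedContinuousFunction.ofNormedAddCommGroup
        (fun t : ℝ≥0 => T t z)
        ((hT.continuousOn z).comp_continuous NNReal.continuous_coe fun t => t.2) _ (hJb z)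
      map_add' := fun z₁ z₂ => by ext t; simp
      map_smul' := fun c z => by ext t; simp }
  let J : Z →L[ℝ] (ℝ≥0 →ᵇ Z) := J₀.mkContinuous M fun z =>
    (BoundedContinuousFunction.norm_le (by positivity)).2 (hJb z)
  have hJ : ∀ (z : Z) (t : ℝ≥0), J z t = T t z := fun _ _ => rfl
  -- The perturbed trajectory from `z` is the unique solution of `w = J z + Φ w`, that is `w = N (J
  -- z)` with `N = (1 - Φ)⁻¹`.
  obtain ⟨V, hV⟩ := isUnit_one_sub_of_norm_lt_one
    (R := (ℝ≥0 →ᵇ Z) →L[ℝ] (ℝ≥0 →ᵇ Z)) hΦn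
  let N : (ℝ≥0 →ᵇ Z) →L[ℝ] (ℝ≥0 →ᵇ Z) := ↑V⁻¹
  have hN : ∀ w, N w = Φ (N w) + w := fun w => by
    have h : (((V : (ℝ≥0 →ᵇ Z) →L[ℝ] (ℝ≥0 →ᵇ Z)) * N) w) = w := by simp [N]
    rw [hV] at h
    have h' : N w - Φ (N w) = w := h
    rw [← sub_eq_iff_eq_add', h']
  have hN' : ∀ w f, w = f + Φ w → w = N f := fun w f h => by
    have h1 : ((N * (V : (ℝ≥0 →ᵇ Z) →L[ℝ] (ℝ≥0 →ᵇ Z))) w) = w := by simp [N]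
    rw [hV] at h1
    have h2 : N (w - Φ w) = w := h1
    rw [sub_eq_iff_eq_add.2 h] at h2
    exact h2.symm
  let T' : ℝ → Z →L[ℝ] Z := fun t => (BoundedContinuousFunction.evalCLM ℝ t.toNNReal).comp
    (N.comp J)
  have hT' : ∀ t z, T' t z = N (J z) t.toNNReal := fun _ _ => rfl
  have hmild : ∀ z t, 0 ≤ t → T' t z = T t z + mildIntegral T (fun s => G (T' s z)) t := by
    intro z t ht
    have h := congrArg (fun w : ℝ≥0 →ᵇ Z => w t.toNNReal) (hN (J z))
    simp only [BoundedContinuousFunction.coe_add, Pi.add_apply, hΦ, hJ,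
      Real.coe_toNNReal t ht] at h
    rw [hT', h, add_comm]
    rfl
  have hcont : ∀ z, Continuous fun t => T' t z := fun z =>
    (N (J z)).continuous.comp continuous_real_toNNReal
  refine ⟨T', ⟨?_, ?_, fun z => (hcont z).continuousOn⟩, hmild⟩
  · ext z
    rw [hmild z 0 le_rfl]
    simp [mildIntegral, hT.apply_zero]
  · intro s t hs ht
    ext z
    -- The trajectory shifted by `t` solves the same fixed-point equation with initial value `T' t
    -- z`; uniqueness is the semigroup law.
    let w : ℝ≥0 →ᵇ Z := (N (J z)).compContinuous ⟨fun r => t.toNNReal + r, by fun_prop⟩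
    have hw : ∀ r : ℝ, 0 ≤ r → w r.toNNReal = T' (t + r) z := fun r hr => by
      simp only [w, BoundedContinuousFunction.compContinuous_apply, ContinuousMap.coe_mk, hT',
        Real.toNNReal_add ht hr]
    have key : w = J (T' t z) + Φ w := by
      ext r
      have hr : 0 ≤ (r : ℝ) := r.2
      have h1 := hw r hr
      rw [Real.toNNReal_coe] at h1
      have hc : ContinuousOn (fun s => G (T' s z)) (Ici 0) :=
        (G.continuous.comp (hcont z)).continuousOn
      rw [h1, hmild z _ (add_nonneg ht hr), hT.mildIntegral_add hc ht hr, add_comm t (r : ℝ),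
        hT.apply_add hr ht, BoundedContinuousFunction.coe_add, Pi.add_apply, hJ, hΦ,
        ← add_assoc, ← map_add, ← hmild z t ht]
      congr 1
      refine intervalIntegral.integral_congr fun q hq => ?_
      rw [uIcc_of_le hr] at hq
      simp only [hw q hq.1]
    have h2 := hw s hs
    rw [hN' _ _ key] at h2
    rw [add_comm s t, ← h2]
    rfl

/-- The exponential rescaling of a semigroup. -/
noncomputable def expScale (c : ℝ) (T : ℝ → Z →L[ℝ] Z) (t : ℝ) : Z →L[ℝ] Z :=
  Real.exp (c * t) • T t

omit [CompleteSpace Z] in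
theorem IsC0Semigroup.expScale (hT : IsC0Semigroup T) (c : ℝ) :
    IsC0Semigroup (expScale c T) := by
  refine ⟨by simp [DyadicControl.expScale, hT.zero], fun s t hs ht => ?_, fun z => ?_⟩
  · ext z
    simp only [DyadicControl.expScale, smul_apply, hT.apply_add hs ht,
      ContinuousLinearMap.comp_apply, map_smul, smul_smul, mul_add, Real.exp_add]
    rw [mul_comm]
  · have := hT.continuousOn z
    simp only [DyadicControl.expScale, smul_apply]
    fun_prop

/-- The variation of constants formula for a bounded perturbation. -/
theorem IsC0Semigroup.exists_perturbation (hT : IsC0Semigroup T) (G : Z →L[ℝ] Z) :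
    ∃ T' : ℝ → Z →L[ℝ] Z, IsC0Semigroup T' ∧
      ∀ z t, 0 ≤ t → T' t z = T t z + mildIntegral T (fun s => G (T' s z)) t := by
  obtain ⟨M, ω, hM, hω, hb⟩ := hT.exists_norm_le_exp
  -- Rescaling by `exp (-(ω + b) t)` leaves decay rate `b`. This choice gives `M / b * ‖G‖ < 1`, and
  -- undoing the rescaling afterwards preserves the mild equation.
  set b : ℝ := M * ‖G‖ + 1 with hbdef
  have hb0 : 0 < b := by positivity
  obtain ⟨T', hT', h⟩ := (hT.expScale (-(ω + b))).exists_perturbation_of_decay hM.le hb0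
    (fun t ht => by
      rw [DyadicControl.expScale, norm_smul, Real.norm_of_nonneg (Real.exp_pos _).le]
      calc _ ≤ Real.exp (-(ω + b) * t) * (M * Real.exp (ω * t)) := by gcongr; exact hb t ht
        _ = M * (Real.exp (-(ω + b) * t) * Real.exp (ω * t)) := by ring
        _ = _ := by rw [← Real.exp_add]; congr 2; ring) G (by
      rw [div_mul_eq_mul_div, div_lt_one hb0]; linarith)
  refine ⟨DyadicControl.expScale (ω + b) T', hT'.expScale _, fun z t ht => ?_⟩
  have e : ∀ r : ℝ, Real.exp ((ω + b) * r) * Real.exp (-(ω + b) * r) = 1 := fun r => by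
    rw [← Real.exp_add, Real.exp_eq_one_iff]; ring
  simp only [DyadicControl.expScale, smul_apply] at h ⊢
  rw [h z t ht, smul_add, smul_smul, e, one_smul]
  congr 1
  unfold mildIntegral
  rw [← intervalIntegral.integral_smul]
  refine intervalIntegral.integral_congr fun s _ => ?_
  simp only [DyadicControl.expScale, smul_apply, map_smul, smul_smul]
  congr 1
  rw [← Real.exp_add]
  congr 1; ring

/-- The difference quotients of `T'` and `T` at `z` differ by an averaged convolution, which tends
to `G z`. So one converges exactly when the other does, and the domain is unchanged. -/
theorem Generates.of_mild {A : Z →ₗ.[ℝ] Z} (hA : Generates A T) {G : Z →L[ℝ] Z}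
    {T' : ℝ → Z →L[ℝ] Z} (hT' : IsC0Semigroup T')
    (h : ∀ z t, 0 ≤ t → T' t z = T t z + mildIntegral T (fun s => G (T' s z)) t) :
    Generates (boundedPerturbation A G) T' := by
  refine ⟨hT', fun z y => ?_⟩
  have hgr : (z, y) ∈ (boundedPerturbation A G).graph ↔ (z, y - G z) ∈ A.graph := by
    simp only [LinearPMap.mem_graph_iff, boundedPerturbation]
    constructor
    · rintro ⟨x, hx, hy⟩
      refine ⟨x, hx, ?_⟩
      have hy : G (x : Z) + A x = y := hy
      rw [← hy, ← hx]; abel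
    · rintro ⟨x, hx, hy⟩
      refine ⟨x, hx, ?_⟩
      have : G (x : Z) + A x = y := by rw [hy, hx]; abel
      exact this
  have hc : ContinuousOn (fun s => G (T' s z)) (Ici 0) :=
    G.continuous.comp_continuousOn (hT'.continuousOn z)
  have hlim := hA.1.tendsto_mildIntegral hc
  simp only [hT'.apply_zero] at hlim
  have e : ∀ᶠ t : ℝ in 𝓝[>] 0, t⁻¹ • (T' t z - z) =
      t⁻¹ • (T t z - z) + t⁻¹ • mildIntegral T (fun s => G (T' s z)) t := by
    filter_upwards [self_mem_nhdsWithin] with t ht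
    rw [h z t (le_of_lt ht), ← smul_add]; congr 1; abel
  rw [hgr, hA.2, tendsto_congr' e]
  constructor
  · intro h1
    simpa using h1.add hlim
  · intro h1
    simpa using h1.sub hlim

/-- The bounded perturbation theorem. -/
theorem Generates.exists_boundedPerturbation {A : Z →ₗ.[ℝ] Z} (hA : Generates A T)
    (G : Z →L[ℝ] Z) :
    ∃ T' : ℝ → Z →L[ℝ] Z, Generates (boundedPerturbation A G) T' ∧
      ∀ z t, 0 ≤ t → T' t z = T t z + mildIntegral T (fun s => G (T' s z)) t := by
  obtain ⟨T', hT', h⟩ := hA.1.exists_perturbation G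
  exact ⟨T', hA.of_mild hT' h, h⟩

end Perturbation

/-! ### Uniqueness of semigroups and of mild solutions. -/

section Uniqueness

variable {Z : Type*} [NormedAddCommGroup Z] [InnerProductSpace ℝ Z] [CompleteSpace Z]
  {T : ℝ → Z →L[ℝ] Z}

theorem hasDerivWithinAt_Ioi_of_tendsto {E : Type*} [NormedAddCommGroup E] [NormedSpace ℝ E]
    {F : ℝ → E} {y : E} {s : ℝ}
    (h : Tendsto (fun r : ℝ => r⁻¹ • (F (s + r) - F s)) (𝓝[>] 0) (𝓝 y)) :
    HasDerivWithinAt F y (Ioi s) s := by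
  rw [hasDerivWithinAt_iff_tendsto_slope' self_notMem_Ioi]
  have hm : Tendsto (fun x : ℝ => x - s) (𝓝[>] s) (𝓝[>] 0) := by
    refine tendsto_nhdsWithin_iff.2 ⟨?_, ?_⟩
    · have : Tendsto (fun x : ℝ => x - s) (𝓝 s) (𝓝 (s - s)) :=
        (continuous_id.sub continuous_const).tendsto s
      rw [sub_self] at this
      exact this.mono_left nhdsWithin_le_nhds
    · filter_upwards [self_mem_nhdsWithin] with x hx
      exact sub_pos.2 (mem_Ioi.1 hx)
  refine (h.comp hm).congr fun x => ?_
  simp [slope]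

/-- The right derivative of `s ↦ T (t - s) (v s)`. -/
theorem IsC0Semigroup.hasDerivWithinAt_conv (hT : IsC0Semigroup T) {v : ℝ → Z} {y : Z} {s t : ℝ}
    (hst : s < t)
    (h : Tendsto (fun r : ℝ => r⁻¹ • (v (s + r) - T r (v s))) (𝓝[>] 0) (𝓝 y)) :
    HasDerivWithinAt (fun s => T (t - s) (v s)) (T (t - s) y) (Ioi s) s := by
  apply hasDerivWithinAt_Ioi_of_tendsto
  -- By the semigroup law the difference quotient equals `T (t - s - r)` applied to `r⁻¹ • (v (s +
  -- r) - T r (v s))`. Joint continuity then suffices, without differentiability of `v`.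
  have h1 : Tendsto (fun r : ℝ => (t - s - r, r⁻¹ • (v (s + r) - T r (v s)))) (𝓝[>] 0)
      (𝓝 (t - s, y)) := by
    refine Tendsto.prodMk_nhds ?_ h
    have : Tendsto (fun r : ℝ => t - s - r) (𝓝 0) (𝓝 (t - s - 0)) :=
      (continuous_const.sub continuous_id).tendsto 0
    rw [sub_zero] at this
    exact this.mono_left nhdsWithin_le_nhds
  have h2 := (hT.continuous_max.tendsto (t - s, y)).comp h1
  simp only [max_eq_left (sub_pos.2 hst).le] at h2
  refine h2.congr' ?_
  filter_upwards [self_mem_nhdsWithin, Ioo_mem_nhdsGT (sub_pos.2 hst)] with r hr hr'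
  have hr0 : 0 ≤ r := le_of_lt hr
  have h3 : 0 ≤ t - s - r := by linarith [hr'.2]
  simp only [Function.comp_def, max_eq_left h3, map_smul, map_sub]
  rw [← hT.apply_add h3 hr0, sub_add_cancel, sub_add_eq_sub_sub]

/-- The solution of a perturbed mild equation, in terms of the perturbed semigroup. -/
theorem IsC0Semigroup.eq_of_mild_perturbed {S : ℝ → Z →L[ℝ] Z} (hS : IsC0Semigroup S)
    (hT : IsC0Semigroup T) {G : Z →L[ℝ] Z}
    (hTS : ∀ z t, 0 ≤ t → T t z = S t z + mildIntegral S (fun s => G (T s z)) t)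
    {v g : ℝ → Z} {v₀ : Z} (hv : ContinuousOn v (Ici 0)) (hg : ContinuousOn g (Ici 0))
    (h : ∀ t, 0 ≤ t → v t = S t v₀ + mildIntegral S (fun s => G (v s) + g s) t)
    {t : ℝ} (ht : 0 ≤ t) : v t = T t v₀ + mildIntegral T g t := by
  have hf : ContinuousOn (fun s => G (v s) + g s) (Ici 0) :=
    (G.continuous.comp_continuousOn hv).add hg
  have hv0 : v 0 = v₀ := by
    rw [h 0 le_rfl]
    simp [mildIntegral, hS.apply_zero]
  -- After a restart at `s`, `v (s + r)` and `T r (v s)` have the same free term `S r (v s)`. What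
  -- remains are two `S`-convolutions, with right derivatives `G (v s) + g s` and `G (v s)`.
  have hderiv : ∀ s, 0 ≤ s →
      Tendsto (fun r : ℝ => r⁻¹ • (v (s + r) - T r (v s))) (𝓝[>] 0) (𝓝 (g s)) := by
    intro s hs
    have hf' : ContinuousOn (fun r => G (v (s + r)) + g (s + r)) (Ici 0) :=
      hf.comp (f := fun r => s + r) (by fun_prop) fun r hr => add_nonneg hs hr
    have hG : ContinuousOn (fun r => G (T r (v s))) (Ici 0) :=
      G.continuous.comp_continuousOn (hT.continuousOn _)
    have h1 := (hS.tendsto_mildIntegral hf').sub (hS.tendsto_mildIntegral hG)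
    simp only [add_zero, hT.apply_zero, add_sub_cancel_left] at h1
    refine h1.congr' ?_
    filter_upwards [self_mem_nhdsWithin] with r hr
    have hr0 : 0 ≤ r := le_of_lt hr
    rw [h _ (add_nonneg hs hr0), hS.mildIntegral_add hf hs hr0, hTS _ _ hr0, add_comm s r,
      hS.apply_add hr0 hs, ← smul_sub, ← add_assoc, ← map_add, ← h s hs]
    congr 1; abel
  -- Integrating the right derivative of `s ↦ T (t - s) (v s)` over `[0, t]` gives `v t - T t v₀`.
  have := intervalIntegral.integral_eq_sub_of_hasDeriv_right
    (f := fun s => T (t - s) (v s)) (f' := fun s => T (t - s) (g s)) (a := 0) (b := t) ?_ ?_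
    (hT.intervalIntegrable_conv hg le_rfl ht le_rfl)
  · simp only [sub_self, hT.apply_zero, sub_zero, hv0] at this
    rw [mildIntegral, this]; abel
  · rw [uIcc_of_le ht]
    exact hT.continuousOn_apply (by fun_prop) (hv.mono fun s hs => hs.1)
      fun s hs => sub_nonneg.2 hs.2
  · intro s hs
    rw [min_eq_left ht, max_eq_right ht] at hs
    exact hT.hasDerivWithinAt_conv hs.2 (hderiv s hs.1.le)

omit [CompleteSpace Z] in
theorem IsC0Semigroup.continuous_max_apply (hT : IsC0Semigroup T) (z : Z) :
    Continuous fun s : ℝ => T (max s 0) z :=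
  (hT.continuousOn z).comp_continuous (by fun_prop) fun s => le_max_right s 0

/-- The operator `z ↦ ∫ T s z ds` over `[0, h]`. -/
noncomputable def IsC0Semigroup.integral (hT : IsC0Semigroup T) (h : ℝ) : Z →L[ℝ] Z :=
  LinearMap.mkContinuousOfExistsBound
    { toFun := fun z => ∫ s in (0 : ℝ)..h, T (max s 0) z
      map_add' := fun x y => by
        simp only [map_add]
        exact intervalIntegral.integral_add ((hT.continuous_max_apply x).intervalIntegrable _ _)
          ((hT.continuous_max_apply y).intervalIntegrable _ _)
      map_smul' := fun c x => by
        simp only [map_smul, RingHom.id_apply]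
        exact intervalIntegral.integral_smul c _ } (by
    obtain ⟨M, -, hb⟩ := hT.exists_norm_le_Icc |h|
    refine ⟨M * |h|, fun z => ?_⟩
    have := intervalIntegral.norm_integral_le_of_norm_le_const (a := 0) (b := h)
      (f := fun s => T (max s 0) z) (C := M * ‖z‖) fun s hs => by
        refine ContinuousLinearMap.le_of_opNorm_le _ (hb _ ⟨le_max_right _ _, ?_⟩) _
        refine max_le ?_ (abs_nonneg _)
        rw [uIoc, mem_Ioc] at hs
        exact hs.2.trans (max_le (abs_nonneg _) (le_abs_self _))
    rw [sub_zero] at this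
    calc _ ≤ _ := this
      _ = _ := by ring)

theorem IsC0Semigroup.integral_apply (hT : IsC0Semigroup T) {h : ℝ} (hh : 0 ≤ h) (z : Z) :
    hT.integral h z = ∫ s in (0 : ℝ)..h, T s z := by
  have e : ∫ s in (0 : ℝ)..h, T (max s 0) z = ∫ s in (0 : ℝ)..h, T s z := by
    refine intervalIntegral.integral_congr fun s hs => ?_
    rw [uIcc_of_le hh] at hs
    simp [max_eq_left hs.1]
  exact e

omit [CompleteSpace Z] in
theorem IsC0Semigroup.intervalIntegrable (hT : IsC0Semigroup T) {a b : ℝ} (ha : 0 ≤ a)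
    (hb : 0 ≤ b) (z : Z) : IntervalIntegrable (fun s => T s z) volume a b :=
  ((hT.continuousOn z).mono fun _ hs => (le_min ha hb).trans hs.1).intervalIntegrable

theorem IsC0Semigroup.apply_integral (hT : IsC0Semigroup T) {t h : ℝ} (ht : 0 ≤ t) (hh : 0 ≤ h)
    (z : Z) : T t (hT.integral h z) = hT.integral (t + h) z - hT.integral t z := by
  rw [hT.integral_apply hh, hT.integral_apply ht, hT.integral_apply (add_nonneg ht hh),
    ← ContinuousLinearMap.intervalIntegral_comp_comm _ (hT.intervalIntegrable le_rfl hh z),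
    intervalIntegral.integral_interval_sub_left
      (hT.intervalIntegrable le_rfl (add_nonneg ht hh) z) (hT.intervalIntegrable le_rfl ht z)]
  have := intervalIntegral.integral_comp_add_left (a := 0) (b := h) (fun r => T r z) t
  rw [add_zero] at this
  rw [← this]
  refine intervalIntegral.integral_congr fun s hs => ?_
  rw [uIcc_of_le hh] at hs
  exact (hT.apply_add ht hs.1 z).symm

theorem IsC0Semigroup.integral_apply_comm (hT : IsC0Semigroup T) {t h : ℝ} (ht : 0 ≤ t)
    (hh : 0 ≤ h) (z : Z) : hT.integral h (T t z) = T t (hT.integral h z) := by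
  rw [hT.integral_apply hh, hT.integral_apply hh,
    ← ContinuousLinearMap.intervalIntegral_comp_comm _ (hT.intervalIntegrable le_rfl hh z)]
  refine intervalIntegral.integral_congr fun s hs => ?_
  rw [uIcc_of_le hh] at hs
  rw [← hT.apply_add ht hs.1, ← hT.apply_add hs.1 ht, add_comm]

theorem IsC0Semigroup.tendsto_integral (hT : IsC0Semigroup T) (z : Z) :
    Tendsto (fun h : ℝ => h⁻¹ • hT.integral h z) (𝓝[>] 0) (𝓝 z) := by
  refine (hT.tendsto_mildIntegral (g := fun _ => z) continuousOn_const).congr' ?_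
  filter_upwards [self_mem_nhdsWithin] with h hh
  rw [hT.integral_apply (le_of_lt hh), mildIntegral]
  have := intervalIntegral.integral_comp_sub_left (a := 0) (b := h) (fun r => T r z) h
  rw [this]; simp

/-- Both `(T r - 1) ∫₀ʰ T` and `(T h - 1) ∫₀ʳ T` are the same difference of integrals; dividing the
second by `r` shows that the limit is `T h z - z`. -/
theorem Generates.integral_mem_domain {A : Z →ₗ.[ℝ] Z} (hA : Generates A T) {h : ℝ} (hh : 0 ≤ h)
    (z : Z) : hA.1.integral h z ∈ A.domain := by
  refine LinearPMap.mem_domain_of_mem_graph (y := T h z - z) ((hA.2 _ _).2 ?_)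
  refine ((hA.1.tendsto_integral (T h z)).sub (hA.1.tendsto_integral z)).congr' ?_
  filter_upwards [self_mem_nhdsWithin] with r hr
  have hr0 : 0 ≤ r := le_of_lt hr
  rw [hA.1.apply_integral hr0 hh, hA.1.integral_apply_comm hh hr0, hA.1.apply_integral hh hr0,
    ← smul_sub, add_comm h r, sub_right_comm]

theorem Generates.dense_domain {A : Z →ₗ.[ℝ] Z} (hA : Generates A T) :
    Dense (A.domain : Set Z) := fun z =>
  mem_closure_of_tendsto (hA.1.tendsto_integral z) (by
    filter_upwards [self_mem_nhdsWithin] with h hh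
    exact A.domain.smul_mem _ (hA.integral_mem_domain (le_of_lt hh) z))

omit [CompleteSpace Z] in
theorem Generates.tendsto_apply {A : Z →ₗ.[ℝ] Z} (hA : Generates A T) (x : A.domain) :
    Tendsto (fun h : ℝ => h⁻¹ • (T h x - x)) (𝓝[>] 0) (𝓝 (A x)) :=
  (hA.2 x (A x)).1 (A.mem_graph x)

omit [CompleteSpace Z] in
theorem Generates.apply_mem_domain {A : Z →ₗ.[ℝ] Z} (hA : Generates A T) (x : A.domain) {t : ℝ}
    (ht : 0 ≤ t) : T t x ∈ A.domain := by
  refine LinearPMap.mem_domain_of_mem_graph (y := T t (A x)) ((hA.2 _ _).2 ?_)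
  refine (((T t).continuous.tendsto _).comp (hA.tendsto_apply x)).congr' ?_
  filter_upwards [self_mem_nhdsWithin] with r hr
  simp only [Function.comp_def, map_smul, map_sub]
  rw [← hA.1.apply_add ht (le_of_lt hr), ← hA.1.apply_add (le_of_lt hr) ht, add_comm]

/-- A generator determines its semigroup. -/
theorem Generates.unique {A : Z →ₗ.[ℝ] Z} {T₁ T₂ : ℝ → Z →L[ℝ] Z} (h₁ : Generates A T₁)
    (h₂ : Generates A T₂) {t : ℝ} (ht : 0 ≤ t) : T₁ t = T₂ t := by
  refine ContinuousLinearMap.coeFn_injective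
    (Continuous.ext_on h₁.dense_domain (T₁ t).continuous (T₂ t).continuous fun x hx => ?_)
  -- For `x` in the domain, `s ↦ T₁ (t - s) (T₂ s x)` has right derivative zero and joins `T₁ t x`
  -- to `T₂ t x`.
  have := intervalIntegral.integral_eq_sub_of_hasDeriv_right
    (f := fun s => T₁ (t - s) (T₂ s x)) (f' := fun s => T₁ (t - s) 0) (a := 0) (b := t) ?_ ?_
    (by simp)
  · simp only [map_zero, intervalIntegral.integral_zero, sub_self, h₁.1.apply_zero, sub_zero,
      h₂.1.apply_zero] at this
    exact (sub_eq_zero.1 this.symm).symm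
  · rw [uIcc_of_le ht]
    exact h₁.1.continuousOn_apply (by fun_prop)
      ((h₂.1.continuousOn x).mono fun s hs => hs.1) fun s hs => sub_nonneg.2 hs.2
  · intro s hs
    rw [min_eq_left ht, max_eq_right ht] at hs
    refine h₁.1.hasDerivWithinAt_conv hs.2 ?_
    let y : A.domain := ⟨T₂ s x, h₂.apply_mem_domain ⟨x, hx⟩ hs.1.le⟩
    have h := (h₂.tendsto_apply y).sub (h₁.tendsto_apply y)
    rw [sub_self] at h
    refine h.congr' ?_
    filter_upwards [self_mem_nhdsWithin] with r hr
    rw [add_comm s r, h₂.1.apply_add (le_of_lt hr) hs.1.le, ← smul_sub]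
    congr 1
    simp only [y]; abel

/-- `A + G₂` is the perturbation of `A + G₁` by `G₂ - G₁`, and its semigroup is unique. This
compares the closed loop with the stable semigroup supplied by detectability. -/
theorem Generates.perturbation_mild {A : Z →ₗ.[ℝ] Z} {G₁ G₂ : Z →L[ℝ] Z}
    {T₁ T₂ : ℝ → Z →L[ℝ] Z} (h₁ : Generates (boundedPerturbation A G₁) T₁)
    (h₂ : Generates (boundedPerturbation A G₂) T₂) (z : Z) {t : ℝ} (ht : 0 ≤ t) :
    T₂ t z = T₁ t z + mildIntegral T₁ (fun s => (G₂ - G₁) (T₂ s z)) t := by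
  obtain ⟨T₃, h₃, h⟩ := h₁.exists_boundedPerturbation (G₂ - G₁)
  have e : boundedPerturbation (boundedPerturbation A G₁) (G₂ - G₁) =
      boundedPerturbation A G₂ := by
    unfold boundedPerturbation
    rw [vadd_vadd]
    congr 1
    ext z
    simp
  rw [e] at h₃
  rw [h₂.unique h₃ ht, h z t ht]
  congr 1
  refine intervalIntegral.integral_congr fun s hs => ?_
  rw [uIcc_of_le ht] at hs
  simp only
  rw [h₂.unique h₃ hs.1]

end Uniqueness

/-! ### Strong continuity of the adjoint semigroup. -/

section Adjoint

variable {Z : Type*} [NormedAddCommGroup Z] [InnerProductSpace ℝ Z] [CompleteSpace Z]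
  {T : ℝ → Z →L[ℝ] Z}

theorem continuousOn_Ici_of_forall_Icc {E : Type*} [TopologicalSpace E] {f : ℝ → E} {a : ℝ}
    (h : ∀ b, ContinuousOn f (Icc a b)) : ContinuousOn f (Ici a) := fun t ht => by
  refine (h (t + 1) t ⟨ht, by linarith⟩).mono_of_mem_nhdsWithin ?_
  filter_upwards [self_mem_nhdsWithin, mem_nhdsWithin_of_mem_nhds (Iio_mem_nhds (lt_add_one t))]
    with s hs hs'
  exact ⟨hs, le_of_lt hs'⟩

/-- Integration upgrades strong continuity to norm continuity (Lipschitz with the local bound of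
`‖T‖`), and norm continuity survives taking adjoints. -/
theorem IsC0Semigroup.continuousOn_integral (hT : IsC0Semigroup T) :
    ContinuousOn hT.integral (Ici 0) := by
  refine continuousOn_Ici_of_forall_Icc fun b => ?_
  obtain ⟨M, hM, hb⟩ := hT.exists_norm_le_Icc b
  refine LipschitzOnWith.continuousOn (K := M.toNNReal) (LipschitzOnWith.of_dist_le_mul ?_)
  intro s hs t ht
  rw [dist_eq_norm, Real.coe_toNNReal _ hM.le, Real.dist_eq]
  refine ContinuousLinearMap.opNorm_le_bound _ (by positivity) fun z => ?_
  rw [sub_apply, hT.integral_apply hs.1, hT.integral_apply ht.1,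
    intervalIntegral.integral_interval_sub_left (hT.intervalIntegrable le_rfl hs.1 z)
      (hT.intervalIntegrable le_rfl ht.1 z)]
  have := intervalIntegral.norm_integral_le_of_norm_le_const (a := t) (b := s)
    (f := fun r => T r z) (C := M * ‖z‖) fun r hr => by
      rw [uIoc, mem_Ioc] at hr
      exact ContinuousLinearMap.le_of_opNorm_le _
        (hb r ⟨(le_min ht.1 hs.1).trans hr.1.le, hr.2.trans (max_le ht.2 hs.2)⟩) _
  calc _ ≤ _ := this
    _ = _ := by ring

/-- On a Hilbert space the adjoint semigroup is strongly continuous. -/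
theorem IsC0Semigroup.adjoint (hT : IsC0Semigroup T) :
    IsC0Semigroup fun t => ContinuousLinearMap.adjoint (T t) := by
  refine ⟨?_, fun s t hs ht => ?_, fun y => ?_⟩
  · rw [hT.zero]; exact ContinuousLinearMap.adjoint_id
  · rw [add_comm, hT.add t s ht hs, ContinuousLinearMap.adjoint_comp]
  -- On the ranges of the adjoint integrals, `T(t)*` acts as the adjoint of `hT.integral (t + h) -
  -- hT.integral t`, which is norm continuous in `t`.
  let D : Set Z := {y | ∃ h, 0 ≤ h ∧ ∃ x, y = ContinuousLinearMap.adjoint (hT.integral h) x}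
  have hD : ∀ y ∈ Submodule.span ℝ D,
      ContinuousOn (fun t => ContinuousLinearMap.adjoint (T t) y) (Ici 0) := by
    intro y hy
    induction hy using Submodule.span_induction with
    | mem y hy =>
      obtain ⟨h, hh, x, rfl⟩ := hy
      have hc : ContinuousOn (fun t => ContinuousLinearMap.adjoint
          (hT.integral (t + h) - hT.integral t) x) (Ici 0) := by
        have h1 : ContinuousOn (fun t => hT.integral (t + h) - hT.integral t) (Ici 0) :=
          (hT.continuousOn_integral.comp (f := fun t => t + h) (by fun_prop)
            fun t ht => add_nonneg ht hh).sub hT.continuousOn_integral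
        exact (ContinuousLinearMap.adjoint.continuous.comp_continuousOn h1).clm_apply
          continuousOn_const
      refine hc.congr fun t ht => ?_
      have e : hT.integral (t + h) - hT.integral t = (hT.integral h).comp (T t) := by
        ext z
        rw [ContinuousLinearMap.comp_apply, hT.integral_apply_comm ht hh,
          hT.apply_integral ht hh, sub_apply]
      simp only [e, ContinuousLinearMap.adjoint_comp, ContinuousLinearMap.comp_apply]
    | zero => simpa using continuousOn_const
    | add x y _ _ hx hy => simpa only [map_add] using ContinuousOn.fun_add hx hy
    | smul c x _ hx => simpa only [map_smul] using ContinuousOn.fun_const_smul hx c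
  -- A vector orthogonal to `D` is killed by every `hT.integral h`, hence is zero as the limit of
  -- its averages.
  have hdense : closure (Submodule.span ℝ D : Set Z) = univ := by
    have : (Submodule.span ℝ D).topologicalClosure = ⊤ := by
      rw [Submodule.topologicalClosure_eq_top_iff, Submodule.eq_bot_iff]
      intro w hw
      have h0 : ∀ h, 0 ≤ h → hT.integral h w = 0 := fun h hh => by
        refine ext_inner_left ℝ fun x => ?_
        rw [inner_zero_right, ← ContinuousLinearMap.adjoint_inner_left]
        exact (Submodule.mem_orthogonal _ _).1 hw _ (Submodule.subset_span ⟨h, hh, x, rfl⟩)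
      refine tendsto_nhds_unique (hT.tendsto_integral w) (tendsto_const_nhds.congr' ?_)
      filter_upwards [self_mem_nhdsWithin] with h hh
      rw [h0 h (le_of_lt hh), smul_zero]
    rw [← Submodule.topologicalClosure_coe, this, Submodule.top_coe]
  refine continuousOn_Ici_of_forall_Icc fun b => ?_
  obtain ⟨M, hM, hb⟩ := hT.exists_norm_le_Icc b
  have := continuousOn_prod_of_subset_closure_continuousOn_lipschitzOnWith'
    (fun p : ℝ × Z => ContinuousLinearMap.adjoint (T p.1) p.2) (s := Icc 0 b) (t := univ)
    (subset_univ (Submodule.span ℝ D : Set Z)) (by rw [hdense]) M.toNNReal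
    (fun t ht => by
      refine ((ContinuousLinearMap.adjoint (T t)).lipschitz.weaken ?_).lipschitzOnWith
      rw [← NNReal.coe_le_coe, Real.coe_toNNReal _ hM.le, coe_nnnorm,
        LinearIsometryEquiv.norm_map]
      exact hb t ht)
    (fun y hy => (hD y hy).mono fun t ht => ht.1)
  exact this.comp (f := fun t => (t, y)) (by fun_prop) fun t ht => ⟨ht, mem_univ _⟩

end Adjoint

/-! ### Datko's theorem and stability under square-integrable perturbations. -/

section Stability

/-- `L²` bounds for the convolution of an `L²` function with a decaying exponential. -/
theorem exists_exp_conv_bound {b κ : ℝ} (hb : 0 < b) {g : ℝ → ℝ} (hg : Continuous g)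
    (hκ : ∀ t, 0 ≤ t → ∫ s in (0 : ℝ)..t, g s ^ 2 ≤ κ) :
    ∃ ψ : ℝ → ℝ, Continuous ψ ∧ ∀ t, 0 ≤ t →
      b * (∫ s in (0 : ℝ)..t, Real.exp (-b * (t - s)) * g s) ^ 2 ≤ ψ t ∧ ψ t ≤ κ ∧
      ∫ s in (0 : ℝ)..t, ψ s ≤ κ / b := by
  -- `ψ` solves `ψ' = -b ψ + g²` with `ψ 0 = 0`. Integrating, `ψ t + b ∫ ψ = ∫ g² ≤ κ`, which yields
  -- both the pointwise and the integral bound.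
  set ψ : ℝ → ℝ := fun t => Real.exp (-b * t) * ∫ s in (0 : ℝ)..t, Real.exp (b * s) * g s ^ 2
    with hψ
  have hint : Continuous fun s => Real.exp (b * s) * g s ^ 2 := by fun_prop
  have hd : ∀ t, HasDerivAt ψ (-b * ψ t + g t ^ 2) t := fun t => by
    have h1 : HasDerivAt (fun t : ℝ => Real.exp (-b * t)) (Real.exp (-b * t) * -b) t := by
      simpa using ((hasDerivAt_id t).const_mul (-b)).exp
    have h2 := h1.mul (hint.integral_hasStrictDerivAt 0 t).hasDerivAt
    refine h2.congr_deriv ?_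
    have e : Real.exp (-b * t) * Real.exp (b * t) = 1 := by
      rw [← Real.exp_add, Real.exp_eq_one_iff]; ring
    rw [← mul_assoc (Real.exp (-b * t)) (Real.exp (b * t)), e]
    ring
  have hc : Continuous ψ := continuous_iff_continuousAt.2 fun t => (hd t).continuousAt
  have hnn : ∀ t, 0 ≤ t → 0 ≤ ψ t := fun t ht =>
    mul_nonneg (Real.exp_pos _).le
      (intervalIntegral.integral_nonneg ht fun s _ => by positivity)
  refine ⟨ψ, hc, fun t ht => ?_⟩
  have h1 := intervalIntegral.integral_eq_sub_of_hasDerivAt (a := 0) (b := t)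
    (fun s _ => hd s) (by apply Continuous.intervalIntegrable; fun_prop)
  rw [intervalIntegral.integral_add (by apply Continuous.intervalIntegrable; fun_prop)
    (by apply Continuous.intervalIntegrable; fun_prop),
    intervalIntegral.integral_const_mul] at h1
  have h0 : ψ 0 = 0 := by simp [hψ]
  have h2 : 0 ≤ ∫ s in (0 : ℝ)..t, ψ s :=
    intervalIntegral.integral_nonneg ht fun s hs => hnn s hs.1
  have h3 := hκ t ht
  refine ⟨?_, by nlinarith [mul_nonneg hb.le h2], ?_⟩
  · set x := ∫ s in (0 : ℝ)..t, Real.exp (-b * (t - s)) * g s with hx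
    -- Weighted Cauchy–Schwarz by completing the square: the weight has mass at most `1 / b`, so `b
    -- * x` stands in for the weighted mean of `g`.
    have h4 : 0 ≤ ∫ s in (0 : ℝ)..t, Real.exp (-b * (t - s)) * (g s - b * x) ^ 2 :=
      intervalIntegral.integral_nonneg ht fun s _ => by positivity
    have e1 : ∀ s, Real.exp (-b * (t - s)) * (g s - b * x) ^ 2 =
        Real.exp (-b * t) * (Real.exp (b * s) * g s ^ 2) -
          2 * b * x * (Real.exp (-b * (t - s)) * g s) +
          (b * x) ^ 2 * Real.exp (-b * (t - s)) := fun s => by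
      have : Real.exp (-b * (t - s)) = Real.exp (-b * t) * Real.exp (b * s) := by
        rw [← Real.exp_add]; congr 1; ring
      rw [this]; ring
    simp only [e1] at h4
    rw [intervalIntegral.integral_add (by apply Continuous.intervalIntegrable; fun_prop)
      (by apply Continuous.intervalIntegrable; fun_prop),
      intervalIntegral.integral_sub (by apply Continuous.intervalIntegrable; fun_prop)
      (by apply Continuous.intervalIntegrable; fun_prop),
      intervalIntegral.integral_const_mul, intervalIntegral.integral_const_mul,
      intervalIntegral.integral_const_mul, integral_exp_neg_sub hb, ← hx] at h4
    have h5 : (b * x) ^ 2 * ((1 - Real.exp (-b * t)) / b) ≤ b * x ^ 2 := by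
      have : (b * x) ^ 2 * ((1 - Real.exp (-b * t)) / b) =
          b * x ^ 2 * (1 - Real.exp (-b * t)) := by field_simp
      rw [this]
      exact mul_le_of_le_one_right (by positivity) (by linarith [Real.exp_pos (-b * t)])
    have h6 : 0 ≤ ψ t - 2 * b * x * x + b * x ^ 2 := by simp only [hψ]; linarith
    linarith
  · rw [le_div_iff₀ hb]
    linarith [hnn t ht]

variable {Z : Type*} [NormedAddCommGroup Z] [InnerProductSpace ℝ Z]
  {T : ℝ → Z →L[ℝ] Z}

theorem IsC0Semigroup.isExpStable_of_norm_le_exp_neg_one (hT : IsC0Semigroup T) {M t₀ : ℝ} (ht₀ : 0 < t₀)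
    (hM : 0 < M) (hb : ∀ t ∈ Icc 0 t₀, ‖T t‖ ≤ M) (h : ‖T t₀‖ ≤ Real.exp (-1)) :
    IsExpStable T := by
  refine ⟨M * Real.exp 1, 1 / t₀, by positivity, by positivity, fun t ht => ?_⟩
  refine (hT.norm_le_mul_exp_floor ht₀ hb h ht).trans ?_
  rw [mul_assoc, ← Real.exp_add]
  gcongr
  have := (Nat.lt_floor_add_one (t / t₀)).le
  have e : -(1 / t₀) * t = -(t / t₀) := by ring
  rw [e]; linarith

/-- Datko's theorem, for a bounded semigroup. -/
theorem IsC0Semigroup.isExpStable_of_integral_le (hT : IsC0Semigroup T) {c₁ c₂ : ℝ}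
    (hc₁ : 0 ≤ c₁) (hc₂ : 0 ≤ c₂)
    (h₁ : ∀ z t, 0 ≤ t → ‖T t z‖ ^ 2 ≤ c₁ * ‖z‖ ^ 2)
    (h₂ : ∀ z t, 0 ≤ t → ∫ s in (0 : ℝ)..t, ‖T s z‖ ^ 2 ≤ c₂ * ‖z‖ ^ 2) : IsExpStable T := by
  -- Writing `T t = T (t - s) T s` bounds `‖T t z‖²` by `c₁ ‖T s z‖²` for every `s ≤ t`; average
  -- over `s`.
  have key : ∀ z t, 0 ≤ t → t * ‖T t z‖ ^ 2 ≤ c₁ * c₂ * ‖z‖ ^ 2 := by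
    intro z t ht
    have hc : ContinuousOn (fun s => ‖T s z‖ ^ 2) (uIcc 0 t) := by
      rw [uIcc_of_le ht]
      exact (((hT.continuousOn z).mono fun s hs => hs.1).norm).pow 2
    have : ∫ _ in (0 : ℝ)..t, ‖T t z‖ ^ 2 ≤ ∫ s in (0 : ℝ)..t, c₁ * ‖T s z‖ ^ 2 := by
      refine intervalIntegral.integral_mono_on ht (by simp)
        (hc.const_smul c₁).intervalIntegrable fun s hs => ?_
      have := h₁ (T s z) (t - s) (sub_nonneg.2 hs.2)
      rwa [← hT.apply_add (sub_nonneg.2 hs.2) hs.1, sub_add_cancel] at this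
    rw [intervalIntegral.integral_const_mul, intervalIntegral.integral_const, sub_zero,
      smul_eq_mul] at this
    calc _ ≤ _ := this
      _ ≤ c₁ * (c₂ * ‖z‖ ^ 2) := by gcongr; exact h₂ z t ht
      _ = _ := by ring
  -- Large enough that `c₁ c₂ / t₀ < exp (-2)`, so that `‖T t₀‖ ≤ exp (-1)`.
  set t₀ := c₁ * c₂ * Real.exp 2 + 1 with ht₀
  have ht : 0 < t₀ := by positivity
  refine hT.isExpStable_of_norm_le_exp_neg_one ht (M := Real.sqrt c₁ + 1) (by positivity)
    (fun t ht => ?_) ?_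
  · refine ContinuousLinearMap.opNorm_le_bound _ (by positivity) fun z => ?_
    have : ‖T t z‖ ≤ Real.sqrt c₁ * ‖z‖ := by
      refine abs_le_of_sq_le_sq' ?_ (by positivity) |>.2
      rw [mul_pow, Real.sq_sqrt hc₁]
      exact h₁ z t ht.1
    linarith [norm_nonneg z]
  · refine ContinuousLinearMap.opNorm_le_bound _ (by positivity) fun z => ?_
    refine abs_le_of_sq_le_sq' ?_ (by positivity) |>.2
    have e : Real.exp (-1) ^ 2 = (Real.exp 2)⁻¹ := by
      rw [← Real.exp_neg, ← Real.exp_nat_mul]; norm_num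
    rw [mul_pow, e, inv_mul_eq_div, le_div_iff₀ (Real.exp_pos _)]
    by_contra! hlt
    have h3 := key z t₀ ht.le
    have h4 : 0 < Real.exp 2 := Real.exp_pos _
    have h5 : ‖z‖ ^ 2 * t₀ ≤ ‖T t₀ z‖ ^ 2 * Real.exp 2 * t₀ := by gcongr
    have h6 : ‖z‖ ^ 2 * t₀ ≤ c₁ * c₂ * Real.exp 2 * ‖z‖ ^ 2 := by nlinarith
    have h7 : ‖z‖ ^ 2 ≤ 0 := by rw [ht₀] at h6; nlinarith
    have h8 : z = 0 := by
      rw [← norm_eq_zero]; exact pow_eq_zero_iff two_ne_zero |>.1 (le_antisymm h7 (sq_nonneg _))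
    simp [h8] at hlt

/-- A bounded perturbation of an exponentially stable semigroup by an output that is square
integrable along trajectories is exponentially stable. -/
theorem IsC0Semigroup.isExpStable_of_perturbation {T₁ : ℝ → Z →L[ℝ] Z} (h₁ : IsExpStable T₁)
    (hT : IsC0Semigroup T) {G : Z →L[ℝ] Z}
    (h : ∀ z t, 0 ≤ t → T t z = T₁ t z + mildIntegral T₁ (fun s => G (T s z)) t) {κ : ℝ}
    (hκ0 : 0 ≤ κ)
    (hκ : ∀ z t, 0 ≤ t → ∫ s in (0 : ℝ)..t, ‖G (T s z)‖ ^ 2 ≤ κ * ‖z‖ ^ 2) :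
    IsExpStable T := by
  obtain ⟨M, b, hM, hb, hT₁⟩ := h₁
  have main : ∀ z, ∃ ψ : ℝ → ℝ, Continuous ψ ∧ ∀ t, 0 ≤ t →
      ‖T t z‖ ^ 2 ≤ 2 * M ^ 2 * (Real.exp (-b * t) * ‖z‖ ^ 2 + ψ t / b) ∧ ψ t ≤ κ * ‖z‖ ^ 2 ∧
      ∫ s in (0 : ℝ)..t, ψ s ≤ κ * ‖z‖ ^ 2 / b := by
    intro z
    have hg : Continuous fun s : ℝ => ‖G (T (max s 0) z)‖ :=
      (G.continuous.comp (hT.continuous_max_apply z)).norm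
    obtain ⟨ψ, hψc, hψ⟩ := exists_exp_conv_bound hb hg (κ := κ * ‖z‖ ^ 2) fun t ht => by
      refine le_of_eq_of_le (intervalIntegral.integral_congr fun s hs => ?_) (hκ z t ht)
      rw [uIcc_of_le ht] at hs
      simp [max_eq_left hs.1]
    refine ⟨ψ, hψc, fun t ht => ⟨?_, (hψ t ht).2⟩⟩
    have h1 := (hψ t ht).1
    set x := ∫ s in (0 : ℝ)..t, Real.exp (-b * (t - s)) * ‖G (T (max s 0) z)‖
    have h2 : ‖mildIntegral T₁ (fun s => G (T s z)) t‖ ≤ M * x := by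
      rw [← intervalIntegral.integral_const_mul]
      refine intervalIntegral.norm_integral_le_of_norm_le ht
        (Eventually.of_forall fun s hs => ?_)
        (by apply Continuous.intervalIntegrable; fun_prop)
      rw [max_eq_left hs.1.le, ← mul_assoc]
      exact ContinuousLinearMap.le_of_opNorm_le _ (hT₁ _ (sub_nonneg.2 hs.2)) _
    have h3 : ‖T t z‖ ≤ M * (Real.exp (-b * t) * ‖z‖ + x) := by
      rw [h z t ht]
      refine (norm_add_le _ _).trans ?_
      have := ContinuousLinearMap.le_of_opNorm_le _ (hT₁ t ht) z
      linarith
    have hx : 0 ≤ x := intervalIntegral.integral_nonneg ht fun s _ => by positivity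
    have h4 : ‖T t z‖ ^ 2 ≤ (M * (Real.exp (-b * t) * ‖z‖ + x)) ^ 2 := by gcongr
    have h5 : x ^ 2 ≤ ψ t / b := by rw [le_div_iff₀ hb]; linarith
    have h6 : (Real.exp (-b * t) * ‖z‖) ^ 2 ≤ Real.exp (-b * t) * ‖z‖ ^ 2 := by
      rw [mul_pow]
      gcongr
      rw [sq]
      exact mul_le_of_le_one_left (Real.exp_pos _).le
        (Real.exp_le_one_iff.2 (by nlinarith [mul_nonneg hb.le ht]))
    calc _ ≤ _ := h4
      _ = M ^ 2 * (Real.exp (-b * t) * ‖z‖ + x) ^ 2 := by ring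
      _ ≤ M ^ 2 * (2 * (Real.exp (-b * t) * ‖z‖ ^ 2 + ψ t / b)) := by
        gcongr
        nlinarith [sq_nonneg (Real.exp (-b * t) * ‖z‖ - x)]
      _ = _ := by ring
  -- `c₁` comes from `exp (-b t) ≤ 1` and `ψ ≤ κ ‖z‖²`; `c₂` from the integrals of these two terms,
  -- at most `1 / b` and `κ ‖z‖² / b`.
  refine hT.isExpStable_of_integral_le (c₁ := 2 * M ^ 2 * (1 + κ / b))
    (c₂ := 2 * M ^ 2 * (1 / b + κ / b / b)) (by positivity) (by positivity)
    (fun z t ht => ?_) fun z t ht => ?_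
  · obtain ⟨ψ, -, hψ⟩ := main z
    obtain ⟨h1, h2, -⟩ := hψ t ht
    refine h1.trans ?_
    rw [mul_assoc (2 * M ^ 2)]
    gcongr
    rw [add_mul]
    gcongr
    · exact Real.exp_le_one_iff.2 (by nlinarith [mul_nonneg hb.le ht])
    · rw [div_mul_eq_mul_div]; gcongr
  · obtain ⟨ψ, hψc, hψ⟩ := main z
    have hc : ContinuousOn (fun s => ‖T s z‖ ^ 2) (uIcc 0 t) := by
      rw [uIcc_of_le ht]
      exact (((hT.continuousOn z).mono fun s hs => hs.1).norm).pow 2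
    have h1 := intervalIntegral.integral_mono_on (μ := volume) ht hc.intervalIntegrable
      (by apply Continuous.intervalIntegrable; fun_prop) fun s hs => (hψ s hs.1).1
    refine h1.trans ?_
    rw [intervalIntegral.integral_const_mul, intervalIntegral.integral_add
      (by apply Continuous.intervalIntegrable; fun_prop)
      (by apply Continuous.intervalIntegrable; fun_prop), intervalIntegral.integral_mul_const,
      intervalIntegral.integral_div, mul_assoc (2 * M ^ 2)]
    have h2 : ∫ s in (0 : ℝ)..t, Real.exp (-b * s) ≤ 1 / b := by
      have := intervalIntegral.integral_comp_sub_left (a := 0) (b := t)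
        (fun r => Real.exp (-b * r)) t
      rw [sub_self, sub_zero] at this
      rw [← this, integral_exp_neg_sub hb]
      gcongr
      linarith [Real.exp_pos (-b * t)]
    have h3 := (hψ t ht).2.2
    gcongr
    rw [add_mul]
    gcongr
    calc _ ≤ κ * ‖z‖ ^ 2 / b / b := by gcongr
      _ = _ := by ring

end Stability

/-! ### The Riccati equation as a Lyapunov identity. -/

section Riccati

variable {Z Y : Type*} [NormedAddCommGroup Z] [InnerProductSpace ℝ Z] [CompleteSpace Z]
  [NormedAddCommGroup Y] [InnerProductSpace ℝ Y] {n : ℕ}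
  {A : Z →ₗ.[ℝ] Z} {B : EuclideanSpace ℝ (Fin n) →L[ℝ] Z} {C : Z →L[ℝ] Y}
  {R : Matrix (Fin n) (Fin n) ℝ} {P : Z →L[ℝ] Z} {T : ℝ → Z →L[ℝ] Z}

open scoped MatrixOrder in
-- Factor `R⁻¹ = L* L`: the inner product is `‖L y‖²`, while `‖R⁻¹ y‖ ≤ ‖L‖ ‖L y‖`. The bound is in
-- terms of `R⁻¹ y` because the gain is `R⁻¹` applied to `B* P x`.
theorem exists_weightInv_coercive (hR : R.PosDef) :
    ∃ c : ℝ, 0 < c ∧ ∀ y, c * ‖weightInv R y‖ ^ 2 ≤ inner ℝ (weightInv R y) y := by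
  obtain ⟨N, hN⟩ := CStarAlgebra.nonneg_iff_eq_star_mul_self.1 hR.inv.posSemidef.nonneg
  set L := Matrix.toEuclideanCLM (𝕜 := ℝ) N with hL
  have h : weightInv R = (ContinuousLinearMap.adjoint L).comp L := by
    rw [weightInv, hN, map_mul, map_star, ContinuousLinearMap.star_eq_adjoint]
    rfl
  refine ⟨(‖L‖ ^ 2 + 1)⁻¹, by positivity, fun y => ?_⟩
  rw [h, ContinuousLinearMap.comp_apply, ContinuousLinearMap.adjoint_inner_left,
    real_inner_self_eq_norm_sq, inv_mul_le_iff₀ (by positivity)]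
  have := (ContinuousLinearMap.adjoint L).le_opNorm (L y)
  rw [LinearIsometryEquiv.norm_map] at this
  calc _ ≤ (‖L‖ * ‖L y‖) ^ 2 := by gcongr
    _ ≤ _ := by rw [mul_pow]; gcongr; linarith

/-- The left side is the derivative of `⟨x, P x⟩` along the closed loop. The feedback contributes
`⟨K x, B* P x⟩` with coefficient `-2`, the Riccati equation on the diagonal with `+1`. -/
theorem IsRiccatiSolution.inner_closedLoop (hP : IsRiccatiSolution A B C R P)
    (x : (closedLoop A B R P).domain) :
    inner ℝ (x : Z) (P (closedLoop A B R P x)) + inner ℝ (closedLoop A B R P x) (P (x : Z)) =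
      -(‖C x‖ ^ 2 + inner ℝ (lqrGain B R P x) (ContinuousLinearMap.adjoint B (P (x : Z)))) := by
  have hsym : ∀ u w : Z, inner ℝ u (P w) = inner ℝ (P u) w := fun u w => by
    rw [← ContinuousLinearMap.adjoint_inner_left, ← ContinuousLinearMap.star_eq_adjoint,
      hP.selfAdjoint.star_eq]
  have hx : closedLoop A B R P x = -(B (lqrGain B R P (x : Z))) + A x := rfl
  have := hP.riccati x x
  rw [hx, map_add, map_neg, inner_add_right, inner_add_left, inner_neg_right, inner_neg_left,
    ContinuousLinearMap.adjoint_inner_right]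
  rw [real_inner_self_eq_norm_sq, real_inner_comm] at this
  have e1 := hsym (x : Z) (B (lqrGain B R P (x : Z)))
  have e2 := real_inner_comm (x : Z) (P (B (lqrGain B R P (x : Z))))
  have e3 := real_inner_comm (P (x : Z)) (B (lqrGain B R P (x : Z)))
  have e4 := real_inner_comm (x : Z) (P (A x))
  linarith

end Riccati

/-! ### Finite energy and exponential stability of the closed loop. -/

section ClosedLoop

variable {Z Y : Type*} [NormedAddCommGroup Z] [InnerProductSpace ℝ Z] [CompleteSpace Z]
  [NormedAddCommGroup Y] [InnerProductSpace ℝ Y] {n : ℕ}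
  {A : Z →ₗ.[ℝ] Z} {B : EuclideanSpace ℝ (Fin n) →L[ℝ] Z} {C : Z →L[ℝ] Y}
  {R : Matrix (Fin n) (Fin n) ℝ} {P : Z →L[ℝ] Z} {T : ℝ → Z →L[ℝ] Z}

/-- Along closed-loop trajectories the output and the control have finite energy. -/
theorem IsRiccatiSolution.exists_integral_le (hP : IsRiccatiSolution A B C R P) (hR : R.PosDef)
    (hT : Generates (closedLoop A B R P) T) :
    ∃ κ : ℝ, 0 ≤ κ ∧ ∀ z t, 0 ≤ t →
      ∫ s in (0 : ℝ)..t, (‖C (T s z)‖ ^ 2 + ‖lqrGain B R P (T s z)‖ ^ 2) ≤ κ * ‖z‖ ^ 2 := by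
  obtain ⟨c, hc, hcR⟩ := exists_weightInv_coercive hR
  set d := min c 1 with hd
  have hd0 : 0 < d := lt_min hc one_pos
  refine ⟨‖P‖ / d, by positivity, fun z t ht => ?_⟩
  have hT0 := hT.1
  set K := lqrGain B R P with hK
  let f : Z → ℝ := fun x => ‖C x‖ ^ 2 + ‖K x‖ ^ 2
  let e : Z → ℝ := fun x => ‖C x‖ ^ 2 + inner ℝ (K x) (ContinuousLinearMap.adjoint B (P x))
  have hf : Continuous f := by fun_prop
  have he : Continuous e := by fun_prop
  have hfe : ∀ x, d * f x ≤ e x := fun x => by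
    have h1 : c * ‖K x‖ ^ 2 ≤ inner ℝ (K x) (ContinuousLinearMap.adjoint B (P x)) := hcR _
    have h2 : d ≤ c := min_le_left _ _
    have h3 : d ≤ 1 := min_le_right _ _
    simp only [f, e]
    nlinarith [sq_nonneg ‖K x‖, sq_nonneg ‖C x‖]
  have hcomp : ∀ (φ : Z → ℝ), Continuous φ → ∀ z, ContinuousOn (fun s => φ (T s z)) (Icc 0 t) :=
    fun φ hφ z => hφ.comp_continuousOn ((hT0.continuousOn z).mono fun s hs => hs.1)
  have hmem : ∀ x ∈ (closedLoop A B R P).domain,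
      ∫ s in (0 : ℝ)..t, f (T (max s 0) x) ≤ ‖P‖ / d * ‖x‖ ^ 2 := by
    intro x hx
    -- From a domain point the trajectory is right differentiable, so the Lyapunov identity
    -- integrates; nonnegativity of `P` then discards the value at time `t`.
    have h1 := intervalIntegral.integral_eq_sub_of_hasDeriv_right
      (f := fun s => inner ℝ (T s x) (P (T s x))) (f' := fun s => -e (T s x)) (a := 0) (b := t)
      (by
        rw [uIcc_of_le ht]
        exact hcomp (fun x => inner ℝ x (P x)) (by fun_prop) x)
      (by
        intro s hs
        rw [min_eq_left ht, max_eq_right ht] at hs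
        let y : (closedLoop A B R P).domain := ⟨T s x, hT.apply_mem_domain ⟨x, hx⟩ hs.1.le⟩
        have h2 : HasDerivWithinAt (fun s => T s x) (closedLoop A B R P y) (Ioi s) s := by
          refine hasDerivWithinAt_Ioi_of_tendsto ((hT.tendsto_apply y).congr' ?_)
          filter_upwards [self_mem_nhdsWithin] with r hr
          rw [add_comm s r, hT0.apply_add (le_of_lt hr) hs.1.le]
        have h3 := h2.inner ℝ (P.hasFDerivAt.comp_hasDerivWithinAt s h2)
        exact h3.congr_deriv (hP.inner_closedLoop y))
      (by
        refine ContinuousOn.intervalIntegrable ?_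
        rw [uIcc_of_le ht]
        exact (hcomp e he x).neg)
    rw [intervalIntegral.integral_neg, hT0.apply_zero] at h1
    have h2 : d * ∫ s in (0 : ℝ)..t, f (T (max s 0) x) ≤ ∫ s in (0 : ℝ)..t, e (T s x) := by
      rw [← intervalIntegral.integral_const_mul]
      refine intervalIntegral.integral_mono_on ht
        ((continuous_const.mul
          (hf.comp (hT0.continuous_max_apply x))).intervalIntegrable _ _)
        (by
          refine ContinuousOn.intervalIntegrable ?_
          rw [uIcc_of_le ht]
          exact hcomp e he x) fun s hs => ?_
      rw [max_eq_left hs.1]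
      exact hfe _
    have h3 := hP.nonneg (T t x)
    have h4 : inner ℝ x (P x) ≤ ‖P‖ * ‖x‖ ^ 2 := by
      calc _ ≤ ‖x‖ * ‖P x‖ := real_inner_le_norm _ _
        _ ≤ ‖x‖ * (‖P‖ * ‖x‖) := by gcongr; exact P.le_opNorm x
        _ = _ := by ring
    rw [div_mul_eq_mul_div, le_div_iff₀ hd0]
    linarith
  -- Both sides are continuous in `x`, so the estimate passes from the dense domain to all of `Z`.
  have hcl : IsClosed {x : Z | ∫ s in (0 : ℝ)..t, f (T (max s 0) x) ≤ ‖P‖ / d * ‖x‖ ^ 2} := by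
    refine isClosed_le ?_ (by fun_prop)
    refine intervalIntegral.continuous_parametric_intervalIntegral_of_continuous'
      (f := fun x s => f (T (max s 0) x)) ?_ 0 t
    exact hf.comp (hT0.continuous_max.comp continuous_swap)
  have hz := hcl.closure_subset_iff.2 hmem (hT.dense_domain z)
  refine le_of_eq_of_le (intervalIntegral.integral_congr fun s hs => ?_) hz
  rw [uIcc_of_le ht] at hs
  simp only [f, max_eq_left hs.1]

/-- Relative to the stable generator `A + L C`, the closed loop is perturbed by `-B K - L C`, whose
size is controlled by the finite-energy signals `K x` and `C x`. -/
theorem IsRiccatiSolution.isExpStable (hP : IsRiccatiSolution A B C R P) (hR : R.PosDef)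
    (hdet : IsExpDetectable A C) (hT : Generates (closedLoop A B R P) T) : IsExpStable T := by
  obtain ⟨L, T₁, hT₁, hst⟩ := hdet
  obtain ⟨κ, hκ0, hκ⟩ := hP.exists_integral_le hR hT
  have hcont : ∀ (D : Z →L[ℝ] Z) z t, 0 ≤ t →
      ContinuousOn (fun s => ‖D (T s z)‖ ^ 2) (uIcc 0 t) := fun D z t ht => by
    rw [uIcc_of_le ht]
    exact ((D.continuous.comp_continuousOn
      ((hT.1.continuousOn z).mono fun s hs => hs.1)).norm).pow 2
  refine IsC0Semigroup.isExpStable_of_perturbation hst hT.1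
    (fun z t ht => hT₁.perturbation_mild hT z ht) (κ := 2 * (‖L‖ ^ 2 + ‖B‖ ^ 2) * κ)
    (by positivity) fun z t ht => ?_
  have hb : ∀ x, ‖(-(B.comp (lqrGain B R P)) - L.comp C) x‖ ^ 2 ≤
      2 * (‖L‖ ^ 2 + ‖B‖ ^ 2) * (‖C x‖ ^ 2 + ‖lqrGain B R P x‖ ^ 2) := by
    intro x
    have h1 : ‖(-(B.comp (lqrGain B R P)) - L.comp C) x‖ ≤
        ‖B‖ * ‖lqrGain B R P x‖ + ‖L‖ * ‖C x‖ := by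
      calc _ ≤ ‖-(B (lqrGain B R P x))‖ + ‖L (C x)‖ := norm_sub_le _ _
        _ ≤ _ := by
          rw [norm_neg]
          gcongr
          · exact B.le_opNorm _
          · exact L.le_opNorm _
    calc _ ≤ (‖B‖ * ‖lqrGain B R P x‖ + ‖L‖ * ‖C x‖) ^ 2 := by gcongr
      _ ≤ _ := by
        nlinarith [sq_nonneg (‖B‖ * ‖lqrGain B R P x‖ - ‖L‖ * ‖C x‖),
          mul_nonneg (sq_nonneg ‖L‖) (sq_nonneg ‖lqrGain B R P x‖),
          mul_nonneg (sq_nonneg ‖B‖) (sq_nonneg ‖C x‖)]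
  have h1 := intervalIntegral.integral_mono_on (μ := volume) ht
    (hcont _ z t ht).intervalIntegrable
    (g := fun s => 2 * (‖L‖ ^ 2 + ‖B‖ ^ 2) * (‖C (T s z)‖ ^ 2 + ‖lqrGain B R P (T s z)‖ ^ 2))
    (by
      refine ContinuousOn.intervalIntegrable ?_
      rw [uIcc_of_le ht]
      have := (hT.1.continuousOn z).mono fun s (hs : s ∈ Icc 0 t) => hs.1
      fun_prop) fun s _ => hb (T s z)
  rw [intervalIntegral.integral_const_mul] at h1
  refine h1.trans ?_
  rw [mul_assoc _ κ]
  gcongr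
  exact hκ z t ht

end ClosedLoop

/-! ### The observability Gramian and the infinite-horizon feedforward. -/

section Gramian

variable {Z Y : Type*} [NormedAddCommGroup Z] [InnerProductSpace ℝ Z] [CompleteSpace Z]
  [NormedAddCommGroup Y] [InnerProductSpace ℝ Y] [CompleteSpace Y]
  {C : Z →L[ℝ] Y} {T : ℝ → Z →L[ℝ] Z}

theorem IsC0Semigroup.continuousOn_gramianIntegrand (hT : IsC0Semigroup T) (z : Z) :
    ContinuousOn (gramianIntegrand T C z) (Ici 0) :=
  hT.adjoint.continuousOn_apply continuousOn_id
    ((ContinuousLinearMap.adjoint C).continuous.comp_continuousOn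
      (C.continuous.comp_continuousOn (hT.continuousOn z))) fun _ hx => hx

theorem norm_gramianIntegrand_le {M b : ℝ} (hM : 0 ≤ M)
    (hb : ∀ t, 0 ≤ t → ‖T t‖ ≤ M * Real.exp (-b * t)) (z : Z) {t : ℝ} (ht : 0 ≤ t) :
    ‖gramianIntegrand T C z t‖ ≤ M ^ 2 * ‖C‖ ^ 2 * ‖z‖ * Real.exp (-(2 * b) * t) := by
  have h := hb t ht
  calc _ ≤ ‖ContinuousLinearMap.adjoint (T t)‖ * (‖ContinuousLinearMap.adjoint C‖ *
        (‖C‖ * (‖T t‖ * ‖z‖))) := by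
        refine (ContinuousLinearMap.le_opNorm _ _).trans ?_
        gcongr
        refine (ContinuousLinearMap.le_opNorm _ _).trans ?_
        gcongr
        refine (ContinuousLinearMap.le_opNorm _ _).trans ?_
        gcongr
        exact ContinuousLinearMap.le_opNorm _ _
    _ ≤ (M * Real.exp (-b * t)) * (‖C‖ * (‖C‖ * ((M * Real.exp (-b * t)) * ‖z‖))) := by
        rw [LinearIsometryEquiv.norm_map, LinearIsometryEquiv.norm_map]
        gcongr
    _ = M ^ 2 * ‖C‖ ^ 2 * ‖z‖ * (Real.exp (-b * t) * Real.exp (-b * t)) := by ring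
    _ = _ := by rw [← Real.exp_add]; congr 2; ring

theorem IsC0Semigroup.integrableOn_gramianIntegrand (hT : IsC0Semigroup T) (hst : IsExpStable T)
    (z : Z) : IntegrableOn (gramianIntegrand T C z) (Ioi 0) := by
  obtain ⟨M, b, hM, hb, h⟩ := hst
  refine Integrable.mono' ((exp_neg_integrableOn_Ioi 0 (by positivity : 0 < 2 * b)).const_mul
    (M ^ 2 * ‖C‖ ^ 2 * ‖z‖)) ?_ ?_
  · exact ((hT.continuousOn_gramianIntegrand z).mono Ioi_subset_Ici_self).aestronglyMeasurable
      measurableSet_Ioi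
  · exact (ae_restrict_iff' measurableSet_Ioi).2 (Eventually.of_forall fun t ht =>
      norm_gramianIntegrand_le hM.le h z (le_of_lt ht))

/-- The observability Gramian of an exponentially stable semigroup is a bounded operator. -/
theorem IsC0Semigroup.exists_gramian (hT : IsC0Semigroup T) (hst : IsExpStable T) :
    ∃ W : Z →L[ℝ] Z, ∀ z, obsGramian T C z = W z := by
  have hi := fun z => hT.integrableOn_gramianIntegrand (C := C) hst z
  obtain ⟨M, b, hM, hb, h⟩ := hst
  let W₀ : Z →ₗ[ℝ] Z :=
    { toFun := obsGramian T C
      map_add' := fun x y => by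
        unfold obsGramian
        rw [← integral_add (hi x) (hi y)]
        simp only [gramianIntegrand, map_add]
      map_smul' := fun c x => by
        simp only [obsGramian, RingHom.id_apply]
        rw [← integral_smul]
        simp only [gramianIntegrand, map_smul] }
  refine ⟨W₀.mkContinuous (M ^ 2 * ‖C‖ ^ 2 * ∫ t in Ioi (0 : ℝ), Real.exp (-(2 * b) * t))
    fun z => ?_, fun z => rfl⟩
  have := norm_integral_le_of_norm_le (f := gramianIntegrand T C z)
    (μ := volume.restrict (Ioi (0 : ℝ)))
    ((exp_neg_integrableOn_Ioi 0 (by positivity : 0 < 2 * b)).const_mul (M ^ 2 * ‖C‖ ^ 2 * ‖z‖))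
    ((ae_restrict_iff' measurableSet_Ioi).2 (Eventually.of_forall fun t ht =>
      norm_gramianIntegrand_le hM.le h z (le_of_lt ht)))
  rw [integral_const_mul] at this
  calc _ ≤ _ := this
    _ = _ := by ring

/-- Since `vp s = T (s - t) (vp t)`, shifting by `t` turns the feedforward into the Gramian integral
truncated at `t₁ - t`. The minus sign in `σ` cancels the reversed limits of integration. -/
theorem IsC0Semigroup.tendsto_horizonFeedforward (hT : IsC0Semigroup T) (hst : IsExpStable T)
    {vp : ℝ → Z} {vp₀ : Z} (hvp : ∀ t, 0 ≤ t → vp t = T t vp₀) {t : ℝ} (ht : 0 ≤ t) :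
    Tendsto (fun t₁ : ℝ => horizonFeedforward T C (fun s => -C (vp s)) t₁ t) atTop
      (𝓝 (obsGramian T C (vp t))) := by
  have h := intervalIntegral_tendsto_integral_Ioi (l := atTop) (b := fun t₁ : ℝ => t₁ - t) 0
    (hT.integrableOn_gramianIntegrand (C := C) hst (vp t))
    (tendsto_atTop_add_const_right _ _ tendsto_id)
  refine h.congr' ?_
  filter_upwards [eventually_ge_atTop t] with t₁ ht₁
  have := intervalIntegral.integral_comp_sub_right (a := t) (b := t₁)
    (gramianIntegrand T C (vp t)) t
  rw [sub_self] at this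
  rw [← this, horizonFeedforward, intervalIntegral.integral_symm t t₁,
    ← intervalIntegral.integral_neg]
  refine intervalIntegral.integral_congr fun s hs => ?_
  rw [uIcc_of_le ht₁] at hs
  have h1 : 0 ≤ s - t := sub_nonneg.2 hs.1
  simp only [gramianIntegrand, map_neg, neg_neg]
  rw [hvp t ht, hvp s (ht.trans hs.1), ← hT.apply_add h1 ht, sub_add_cancel]

end Gramian

/-! ### Error of the control signals. -/

section ControlError

variable {Z : Type*} [NormedAddCommGroup Z] [InnerProductSpace ℝ Z] [CompleteSpace Z] {n : ℕ}
  {B : EuclideanSpace ℝ (Fin n) →L[ℝ] Z} {R : Matrix (Fin n) (Fin n) ℝ} {P : Z →L[ℝ] Z}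
  {S T : ℝ → Z →L[ℝ] Z}

/-- A plant with the LQR feedback and a bounded feedforward `F vp`, against the LQR closed loop. -/
theorem norm_control_error_le (hS : IsC0Semigroup S) (hT : IsC0Semigroup T)
    (hTS : ∀ z t, 0 ≤ t →
      T t z = S t z + mildIntegral S (fun s => (-(B.comp (lqrGain B R P))) (T s z)) t)
    {M b : ℝ} (hM : 0 < M) (hb : 0 < b) (hTb : ∀ t, 0 ≤ t → ‖T t‖ ≤ M * Real.exp (-b * t))
    (F : Z →L[ℝ] EuclideanSpace ℝ (Fin n)) {vp v vs : ℝ → Z} {vp₀ v₀ vs₀ : Z}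
    (hvp : ∀ t, 0 ≤ t → vp t = T t vp₀)
    (hv : IsMildSolution S (fun τ z => B (-lqrGain B R P z + F (vp τ))) v₀ v)
    (hvs : IsMildSolution S (fun _ z => B (lqrLaw B R P z)) vs₀ vs) {t : ℝ} (ht : 0 ≤ t) :
    ‖-lqrGain B R P (v t) + F (vp t) - lqrLaw B R P (vs t)‖ ≤
      (‖lqrGain B R P‖ * (M + M / b * (‖B‖ * (‖F‖ * M))) + ‖F‖ * M) *
        (‖vp₀‖ + ‖v₀ - vs₀‖) := by
  have hle : ∀ t, 0 ≤ t → ∀ z, ‖T t z‖ ≤ M * ‖z‖ := fun t ht z => by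
    refine ContinuousLinearMap.le_of_opNorm_le _ ((hTb t ht).trans ?_) z
    exact mul_le_of_le_one_right hM.le
      (Real.exp_le_one_iff.2 (by nlinarith [mul_nonneg hb.le ht]))
  have hFb : ∀ t, 0 ≤ t → ‖F (vp t)‖ ≤ ‖F‖ * M * ‖vp₀‖ := fun t ht => by
    rw [hvp t ht, mul_assoc]
    refine (F.le_opNorm _).trans ?_
    gcongr
    exact hle t ht _
  have hvpc : ContinuousOn vp (Ici 0) := (hT.continuousOn vp₀).congr hvp
  -- Passing from `S` to `T` absorbs the LQR feedback. Only `B F vp` drives `v`, and nothing drives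
  -- `vs`.
  have h1 := hS.eq_of_mild_perturbed hT hTS (g := fun s => B (F (vp s))) hv.1 (by fun_prop)
    (v₀ := v₀) (fun t ht => by
      rw [hv.2 t ht]
      simp only [mildIntegral, neg_apply, ContinuousLinearMap.comp_apply, map_add, map_neg]) ht
  have h2 := hS.eq_of_mild_perturbed hT hTS (g := fun s => 0) hvs.1 continuousOn_const
    (v₀ := vs₀) (fun t ht => by
      rw [hvs.2 t ht]
      simp only [mildIntegral, neg_apply, ContinuousLinearMap.comp_apply, lqrLaw, map_neg,
        add_zero]) ht
  have h3 : mildIntegral T (fun _ => 0) t = 0 := by simp [mildIntegral]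
  have h4 := norm_mildIntegral_le hM.le hb hTb (g := fun s => B (F (vp s)))
    (k := ‖B‖ * (‖F‖ * M * ‖vp₀‖)) (fun s hs => (B.le_opNorm _).trans (by
      gcongr; exact hFb s hs)) ht
  have h5 : ‖v t - vs t‖ ≤ M * ‖v₀ - vs₀‖ + M / b * (‖B‖ * (‖F‖ * M * ‖vp₀‖)) := by
    have e : v t - vs t = T t (v₀ - vs₀) + mildIntegral T (fun s => B (F (vp s))) t := by
      rw [h1, h2, h3, map_sub]; abel
    rw [e]
    exact (norm_add_le _ _).trans (add_le_add (hle t ht _) h4)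
  have e : -lqrGain B R P (v t) + F (vp t) - lqrLaw B R P (vs t) =
      F (vp t) - lqrGain B R P (v t - vs t) := by
    rw [lqrLaw, map_sub]; abel
  rw [e]
  have hp := norm_nonneg vp₀
  have hd := norm_nonneg (v₀ - vs₀)
  calc _ ≤ ‖F (vp t)‖ + ‖lqrGain B R P (v t - vs t)‖ := norm_sub_le _ _
    _ ≤ ‖F‖ * M * ‖vp₀‖ + ‖lqrGain B R P‖ *
        (M * ‖v₀ - vs₀‖ + M / b * (‖B‖ * (‖F‖ * M * ‖vp₀‖))) := by
      gcongr
      · exact hFb t ht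
      · exact (ContinuousLinearMap.le_opNorm _ _).trans (by gcongr)
    _ ≤ ‖F‖ * M * (‖vp₀‖ + ‖v₀ - vs₀‖) + ‖lqrGain B R P‖ *
        (M * (‖vp₀‖ + ‖v₀ - vs₀‖) +
          M / b * (‖B‖ * (‖F‖ * M * (‖vp₀‖ + ‖v₀ - vs₀‖)))) := by
      gcongr <;> linarith
    _ = _ := by ring

end ControlError

end DyadicControl

/-! ### The main theorem. -/

theorem lemma3 {Z : Type*} [NormedAddCommGroup Z] [InnerProductSpace ℝ Z] [CompleteSpace Z]
    {nu ny : ℕ}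
    -- the plant: `A` generates the semigroup `S`; `B`, `C` are bounded; the weight is `R > 0`
    (A : Z →ₗ.[ℝ] Z) (S : ℝ → Z →L[ℝ] Z) (hA : DyadicControl.Generates A S)
    (B : EuclideanSpace ℝ (Fin nu) →L[ℝ] Z) (C : Z →L[ℝ] EuclideanSpace ℝ (Fin ny))
    (R : Matrix (Fin nu) (Fin nu) ℝ) (hR : R.PosDef)
    (hstab : DyadicControl.IsExpStabilizable A B)
    (hdet : DyadicControl.IsExpDetectable A C)
    (P : Z →L[ℝ] Z) (hP : DyadicControl.IsRiccatiSolution A B C R P) :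
    -- the closed-loop operator generates a semigroup, and the Gramian integral converges
    ∃ Tm : ℝ → Z →L[ℝ] Z,
      DyadicControl.Generates (DyadicControl.closedLoop A B R P) Tm ∧
      (∀ z : Z, IntegrableOn (DyadicControl.gramianIntegrand Tm C z) (Ioi 0)) ∧
      -- the static feedforward is the limit for an infinite horizon, with `σ = r - y_p = -C v_p`
      (∀ (vp₀ : Z) (vp : ℝ → Z),
        DyadicControl.IsMildSolution Tm (fun _ _ => 0) vp₀ vp →
        ∀ t : ℝ, 0 ≤ t →
          Tendsto (fun T : ℝ =>
              DyadicControl.horizonFeedforward Tm C (fun s => -C (vp s)) T t)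
            atTop (𝓝 (DyadicControl.obsGramian Tm C (vp t)))) ∧
      ∃ M β : ℝ, 0 < M ∧ 0 < β ∧
        -- exponential convergence of the control laws, uniformly in the state `z = v_p + v_h`
        (∀ (vp₀ : Z) (vp : ℝ → Z),
          DyadicControl.IsMildSolution Tm (fun _ _ => 0) vp₀ vp →
          ∀ t : ℝ, 0 ≤ t → ∀ z : Z,
            ‖DyadicControl.regLaw Tm B C R P (vp t) (z - vp t)
                - DyadicControl.lqrLaw B R P z‖
              ≤ M * Real.exp (-β * t) * ‖vp₀‖) ∧
        -- boundedness of the error of the control signals, for the converged-observer system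
        (∀ (vp₀ vh₀ vs₀ : Z) (vp vh vs : ℝ → Z),
          DyadicControl.IsMildSolution Tm (fun _ _ => 0) vp₀ vp →
          DyadicControl.IsMildSolution S
            (fun τ z => B (DyadicControl.regLaw Tm B C R P (vp τ) z)) vh₀ vh →
          DyadicControl.IsMildSolution S
            (fun _ z => B (DyadicControl.lqrLaw B R P z)) vs₀ vs →
          ∀ t : ℝ, 0 ≤ t →
            ‖DyadicControl.regLaw Tm B C R P (vp t) (vh t) - DyadicControl.lqrLaw B R P (vs t)‖
              ≤ M * (‖vp₀‖ + ‖vp₀ + vh₀ - vs₀‖)) ∧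
        -- the same when the law drives the plant `v' = A v + B u`, with `v_h = v - v_p`
        (∀ (vp₀ v₀ vs₀ : Z) (vp v vs : ℝ → Z),
          DyadicControl.IsMildSolution Tm (fun _ _ => 0) vp₀ vp →
          DyadicControl.IsMildSolution S
            (fun τ z => B (DyadicControl.regLaw Tm B C R P (vp τ) (z - vp τ))) v₀ v →
          DyadicControl.IsMildSolution S
            (fun _ z => B (DyadicControl.lqrLaw B R P z)) vs₀ vs →
          ∀ t : ℝ, 0 ≤ t →
            ‖DyadicControl.regLaw Tm B C R P (vp t) (v t - vp t)
                - DyadicControl.lqrLaw B R P (vs t)‖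
              ≤ M * (‖vp₀‖ + ‖v₀ - vs₀‖)) := by
  obtain ⟨T, hT, hTS⟩ := hA.exists_boundedPerturbation (-(B.comp (DyadicControl.lqrGain B R P)))
  have hst : DyadicControl.IsExpStable T := hP.isExpStable hR hdet hT
  have hmild : ∀ (vp₀ : Z) (vp : ℝ → Z),
      DyadicControl.IsMildSolution T (fun _ _ => 0) vp₀ vp → ∀ t, 0 ≤ t → vp t = T t vp₀ :=
    fun vp₀ vp h t ht => by rw [h.2 t ht]; simp
  refine ⟨T, hT, fun z => hT.1.integrableOn_gramianIntegrand hst z,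
    fun vp₀ vp h t ht => hT.1.tendsto_horizonFeedforward hst (hmild vp₀ vp h) ht, ?_⟩
  obtain ⟨W, hW⟩ := hT.1.exists_gramian (C := C) hst
  obtain ⟨M, b, hM, hb, hTb⟩ := hst
  let D : Z →L[ℝ] EuclideanSpace ℝ (Fin nu) := (DyadicControl.weightedAdjoint B R).comp W
  -- As a law for `v_h` the feedforward operator is `-D`; as a law for `z = v_h + v_p`, expanding
  -- `-K (z - v_p) - D v_p` makes it `E = K - D`.
  let E : Z →L[ℝ] EuclideanSpace ℝ (Fin nu) := DyadicControl.lqrGain B R P - D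
  let N : (Z →L[ℝ] EuclideanSpace ℝ (Fin nu)) → ℝ := fun F =>
    ‖DyadicControl.lqrGain B R P‖ * (M + M / b * (‖B‖ * (‖F‖ * M))) + ‖F‖ * M
  have hN : ∀ F, 0 ≤ N F := fun F => by positivity
  have hreg : ∀ x z, DyadicControl.regLaw T B C R P x z =
      -DyadicControl.lqrGain B R P z + (-D) x := fun x z => by
    rw [DyadicControl.regLaw, hW, sub_eq_add_neg]; rfl
  have hreg' : ∀ x z, DyadicControl.regLaw T B C R P x (z - x) =
      -DyadicControl.lqrGain B R P z + E x := fun x z => by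
    rw [hreg, map_sub, show E x = DyadicControl.lqrGain B R P x - D x from rfl, neg_apply]
    abel
  have hE : 0 ≤ ‖E‖ * M := by positivity
  -- The `1` ensures positivity; the other summands serve the three estimates in order. The factor
  -- `2` pays for replacing `vh₀ - vs₀` by `vp₀ + vh₀ - vs₀`.
  refine ⟨1 + ‖E‖ * M + 2 * N (-D) + N E, b, ?_, hb, ?_, ?_, ?_⟩
  · linarith [hN (-D), hN E]
  · intro vp₀ vp hvp t ht z
    rw [hreg', DyadicControl.lqrLaw, hmild _ _ hvp t ht,
      show ∀ x y : EuclideanSpace ℝ (Fin nu), -x + y - -x = y from fun x y => by abel]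
    calc ‖E (T t vp₀)‖ ≤ ‖E‖ * ((M * Real.exp (-b * t)) * ‖vp₀‖) := by
          refine (E.le_opNorm _).trans ?_
          gcongr
          exact ContinuousLinearMap.le_of_opNorm_le _ (hTb t ht) _
      _ = ‖E‖ * M * Real.exp (-b * t) * ‖vp₀‖ := by ring
      _ ≤ _ := by
          gcongr
          linarith [hN (-D), hN E]
  · intro vp₀ vh₀ vs₀ vp vh vs hvp hvh hvs t ht
    simp only [hreg] at hvh ⊢
    refine (DyadicControl.norm_control_error_le hA.1 hT.1 hTS hM hb hTb (-D)
      (hmild _ _ hvp) hvh hvs ht).trans ?_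
    change N (-D) * _ ≤ _
    have h1 : ‖vh₀ - vs₀‖ ≤ ‖vp₀ + vh₀ - vs₀‖ + ‖vp₀‖ := by
      calc _ = ‖(vp₀ + vh₀ - vs₀) - vp₀‖ := by congr 1; abel
        _ ≤ _ := norm_sub_le _ _
    calc _ ≤ N (-D) * (2 * (‖vp₀‖ + ‖vp₀ + vh₀ - vs₀‖)) := by
          gcongr
          linarith [norm_nonneg (vp₀ + vh₀ - vs₀)]
      _ = 2 * N (-D) * (‖vp₀‖ + ‖vp₀ + vh₀ - vs₀‖) := by ring
      _ ≤ _ := by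
          gcongr
          linarith [hN E]
  · intro vp₀ v₀ vs₀ vp v vs hvp hv hvs t ht
    simp only [hreg'] at hv ⊢
    refine (DyadicControl.norm_control_error_le hA.1 hT.1 hTS hM hb hTb E
      (hmild _ _ hvp) hv hvs ht).trans ?_
    change N E * _ ≤ _
    gcongr
    linarith [hN (-D)]
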